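/- Let $\lambda\in(0,1/2)$ and $1<p<q<\infty$, and let $X$ be a random variable with $\mathbb P(X=1-\lambda)=\lambda$ and $\mathbb P(X=-\lambda)=1-\lambda$. Let $\sigma_{p,q}(\lambda)$ be the optimal hypercontractive constant of $X$, i.e. the largest $r\in[0,1)$ such that $$\|1+r\rho X\|_q\le\|1+\rho X\|_p\qquad\text{for all }\rho\in\mathbb R .$$ This maximum exists, and $$\sigma_{p,q}(\lambda)=\frac{(1-y)\left(x+\frac{\lambda}{1-\lambda}\right)}{(1-x)\left(y+\frac{\lambda}{1-\lambda}\right)}$$ for some solution $(x,y)\in(0,1)^2$ of the system $$\frac{\big(\lambda+(1-\lambda)x^p\big)^{1/p}}{\lambda+(1-\lambda)x}=\frac{\big(\lambda+(1-\lambda)y^q\big)^{1/q}}{\lambda+(1-\lambda)y},\qquad \frac{(1-x)(1-x^{p-1})}{\lambda+(1-\lambda)x^p}=\frac{(1-y)(1-y^{q-1})}{\lambda+(1-\lambda)y^q};$$ moreover $\sigma_{p,q}(\lambda)$ is the minimum of the above expression over all solutions $(x,y)\in(0,1)^2$ of this system. In the particular case $q=p^*=p/(p-1)$ one has $$\sigma_{p,p^*}(\lambda)=\frac{\sinh\left(\frac1{p^*}\log\frac{1-\lambda}{\lambda}\right)}{\sinh\left(\frac1p\log\frac{1-\lambda}{\lambda}\right)}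 .$$ -/

import Mathlib

open MeasureTheory

/-- `X` is a real random variable on the probability space `(Ω, μ)` with
`P(X = 1 - l) = l` and `P(X = -l) = 1 - l`. -/
structure IsBiasedBernoulli {Ω : Type*} [MeasurableSpace Ω] (X : Ω → ℝ) (l : ℝ)
    (μ : Measure Ω) : Prop where
  aemeasurable : AEMeasurable X μ
  prob_pos : μ {ω | X ω = 1 - l} = ENNReal.ofReal l
  prob_neg : μ {ω | X ω = -l} = ENNReal.ofReal (1 - l)

/-- `X` is `(p, q, r)`-hypercontractive: `0 ≤ r < 1`, `X ∈ L^q`, and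
`‖1 + r ρ X‖_q ≤ ‖1 + ρ X‖_p` for all real `ρ`. -/
def IsHypercontractive {Ω : Type*} [MeasurableSpace Ω] (X : Ω → ℝ) (p q r : ℝ)
    (μ : Measure Ω) : Prop :=
  0 ≤ r ∧ r < 1 ∧ MemLp X (ENNReal.ofReal q) μ ∧
    ∀ ρ : ℝ, eLpNorm (fun ω => 1 + r * ρ * X ω) (ENNReal.ofReal q) μ ≤
      eLpNorm (fun ω => 1 + ρ * X ω) (ENNReal.ofReal p) μ

/-- The optimal hypercontractivity constant `σ_{p,q}(X)`: the supremum of all `r` for which `X` is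
`(p, q, r)`-hypercontractive. -/
noncomputable def optimalConst {Ω : Type*} [MeasurableSpace Ω] (X : Ω → ℝ) (p q : ℝ)
    (μ : Measure Ω) : ℝ :=
  sSup {r : ℝ | IsHypercontractive X p q r μ}

/-- `(x, y)` is a solution in the open unit square of the two-equation system with
parameters `l`, `p`, `q`. -/
structure IsSystemSolution (l p q x y : ℝ) : Prop where
  x_mem : x ∈ Set.Ioo (0 : ℝ) 1
  y_mem : y ∈ Set.Ioo (0 : ℝ) 1
  eq_norm : (l + (1 - l) * x ^ p) ^ (1 / p) / (l + (1 - l) * x) =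
    (l + (1 - l) * y ^ q) ^ (1 / q) / (l + (1 - l) * y)
  eq_deriv : (1 - x) * (1 - x ^ (p - 1)) / (l + (1 - l) * x ^ p) =
    (1 - y) * (1 - y ^ (q - 1)) / (l + (1 - l) * y ^ q)

/-- The value `(1 - y)(x + l/(1-l)) / ((1 - x)(y + l/(1-l)))`. -/
noncomputable def crossValue (l x y : ℝ) : ℝ :=
  ((1 - y) * (x + l / (1 - l))) / ((1 - x) * (y + l / (1 - l)))

/-!
The variable `1 + ρ X` of mean one runs, up to scaling, through the functions `f = (a, b)` on a
space with two atoms of masses `l` and `1 - l`, and replacing `ρ` by `r ρ` applies the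
self-adjoint operator `T_r f = r f + (1 - r) 𝔼 f`. Hypercontractivity is the bound
`‖T_r f‖_q ≤ ‖f‖_p` for all `f`.

*Only `0 ≤ ρ ≤ 1 / l` matters* (`affineNorm_le_of_forall_mem_Icc`). As `|T_r f| ≤ T_r |f|`, one
may take `f ≥ 0`. If `f` is larger on the big atom and `p ≤ 2`, then among the functions larger on
the small atom there is one with the same mean and the same `p`-th moment; the four atoms of the
two laws alternate in sign, and since `1, v, v^p, (r v + 1 - r)^q` behave like a Chebyshev system,
this function violates the bound whenever `f` does (`exists_reflected_dominating`). The case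
`p > 2` follows by duality.

*Existence of a touching point* (`exists_isGreatest_feasibleSet`). Near `ρ = 0` the quadratic
terms of the two norms force `r² ≤ (p - 1) / (q - 1)`, and at equality the cubic terms, whose sign
is that of the third moment of `X`, violate the bound. So the greatest admissible constant `σ` is
strictly smaller, and by compactness equality occurs at `r = σ` for some `ρ ∈ (0, 1 / l]`.

*The system* (`exists_isSystemSolution_of_tight`, `le_crossValue`). With `x` and `y` the ratios of
the two values of `1 + ρ X` and `1 + σ ρ X`, equality of the norms and stationarity in `ρ` are the
two equations, and `σ = crossValue l x y`; at `ρ = 1 / l` the one-sided stationarity condition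
fails, so `x > 0`. Conversely the first equation alone gives equality of the norms at
`r = crossValue l x y`, which bounds `σ` from above.

*Conjugate exponents.* The explicit solution of `exists_isSystemSolution_conjugate` bounds `σ`
from above by the quotient `r` of hyperbolic sines. For the lower bound, Cauchy–Schwarz for the
positive form `𝔼 (g T_r f)` reduces `‖T_r f‖_q ≤ ‖f‖_p` to `𝔼 (f T_r f) ≤ ‖f‖_p²`
(`contractsAt_of_noiseForm_le`). In the coordinate `s = log ((1 - l) b^p / (l a^p)) / 2` this says
that `cosh(s)^m`, `m = 2 / p`, lies above its tangent at `s = log ((1 - l) / l) / 2` when viewed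
as a function of `cosh(m s)`, and that function is convex (`cosh_rpow_tangent_le`).
-/

/-! ### Reduction to two-point norms -/

/-- The `L^s` norm of the nonnegative function with value `a` on an atom of mass `l` and `b` on an
atom of mass `1 - l`. The arguments are meant to be nonnegative: no absolute values are taken. -/
noncomputable def twoPointNorm (l s a b : ℝ) : ℝ := (l * a ^ s + (1 - l) * b ^ s) ^ (1 / s)

lemma IsBiasedBernoulli.lintegral_comp {Ω : Type*} [MeasurableSpace Ω] {μ : Measure Ω}
    [IsProbabilityMeasure μ] {X : Ω → ℝ} {l : ℝ} (hX : IsBiasedBernoulli X l μ)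
    (hl0 : 0 < l) (hl1 : l < 1) (h : ℝ → ENNReal) (hh : Measurable h) :
    ∫⁻ ω, h (X ω) ∂μ =
      h (1 - l) * ENNReal.ofReal l + h (-l) * ENNReal.ofReal (1 - l) := by
  have hne : (1 - l : ℝ) ≠ -l := by linarith
  have hm := hX.aemeasurable
  have h1 : (μ.map X) {1 - l} = ENNReal.ofReal l := by
    rw [Measure.map_apply_of_aemeasurable hm (measurableSet_singleton _)]; exact hX.prob_pos
  have h2 : (μ.map X) {-l} = ENNReal.ofReal (1 - l) := by
    rw [Measure.map_apply_of_aemeasurable hm (measurableSet_singleton _)]; exact hX.prob_neg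
  have : IsProbabilityMeasure (μ.map X) := Measure.isProbabilityMeasure_map hm
  set F : Finset ℝ := {1 - l, -l} with hF
  have hFm : (μ.map X) (F : Set ℝ) = 1 := by
    rw [← sum_measure_singleton, hF, Finset.sum_pair hne, h1, h2,
      ← ENNReal.ofReal_add hl0.le (by linarith)]
    simp
  have hae : ∀ᵐ x ∂(μ.map X), x ∈ (F : Set ℝ) :=
    (prob_compl_eq_zero_iff F.measurableSet).2 hFm
  rw [← lintegral_map' hh.aemeasurable hm, ← Measure.restrict_eq_self_of_ae_mem hae,
    lintegral_finset, hF, Finset.sum_pair hne, h1, h2]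

lemma IsBiasedBernoulli.eLpNorm_comp {Ω : Type*} [MeasurableSpace Ω] {μ : Measure Ω}
    [IsProbabilityMeasure μ] {X : Ω → ℝ} {l : ℝ} (hX : IsBiasedBernoulli X l μ)
    (hl0 : 0 < l) (hl1 : l < 1) {s : ℝ} (hs : 0 < s) (f : ℝ → ℝ) (hf : Measurable f) :
    eLpNorm (fun ω => f (X ω)) (ENNReal.ofReal s) μ =
      ENNReal.ofReal (twoPointNorm l s |f (1 - l)| |f (-l)|) := by
  have hs' : (ENNReal.ofReal s).toReal = s := ENNReal.toReal_ofReal hs.le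
  rw [eLpNorm_eq_lintegral_rpow_enorm_toReal (by simpa using hs) ENNReal.ofReal_ne_top, hs',
    hX.lintegral_comp hl0 hl1 (fun x => ‖f x‖ₑ ^ s) (by fun_prop), twoPointNorm,
    Real.enorm_eq_ofReal_abs, Real.enorm_eq_ofReal_abs,
    ENNReal.ofReal_rpow_of_nonneg (abs_nonneg _) hs.le,
    ENNReal.ofReal_rpow_of_nonneg (abs_nonneg _) hs.le,
    ← ENNReal.ofReal_mul (by positivity), ← ENNReal.ofReal_mul (by positivity),
    ← ENNReal.ofReal_add (by positivity) (mul_nonneg (by positivity) (by linarith)),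
    ENNReal.ofReal_rpow_of_nonneg
      (add_nonneg (by positivity) (mul_nonneg (by positivity) (by linarith))) (by positivity)]
  congr 2
  ring

/-- `‖1 + ρ X‖_s` for the biased Bernoulli variable `X`. -/
noncomputable def affineNorm (l s ρ : ℝ) : ℝ := twoPointNorm l s |1 + ρ * (1 - l)| |1 - ρ * l|

lemma twoPointNorm_nonneg {l s a b : ℝ} (hl0 : 0 < l) (hl1 : l < 1) (ha : 0 ≤ a) (hb : 0 ≤ b) :
    0 ≤ twoPointNorm l s a b :=
  Real.rpow_nonneg (add_nonneg (mul_nonneg hl0.le (Real.rpow_nonneg ha _))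
    (mul_nonneg (by linarith) (Real.rpow_nonneg hb _))) _

/-- For a biased Bernoulli variable hypercontractivity is a family of real inequalities, one for
each `ρ`; membership in `L^q` is automatic. -/
lemma IsBiasedBernoulli.isHypercontractive_iff {Ω : Type*} [MeasurableSpace Ω] {μ : Measure Ω}
    [IsProbabilityMeasure μ] {X : Ω → ℝ} {l : ℝ} (hX : IsBiasedBernoulli X l μ)
    (hl0 : 0 < l) (hl1 : l < 1) {p q : ℝ} (hp : 0 < p) (hq : 0 < q) (r : ℝ) :
    IsHypercontractive X p q r μ ↔
      0 ≤ r ∧ r < 1 ∧ ∀ ρ : ℝ, affineNorm l q (r * ρ) ≤ affineNorm l p ρ := by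
  have hmem : MemLp X (ENNReal.ofReal q) μ := by
    refine ⟨hX.aemeasurable.aestronglyMeasurable, ?_⟩
    have := hX.eLpNorm_comp hl0 hl1 hq id measurable_id
    simp only [id] at this
    rw [this]
    exact ENNReal.ofReal_lt_top
  have key : ∀ {s : ℝ}, 0 < s → ∀ c : ℝ, eLpNorm (fun ω => 1 + c * X ω) (ENNReal.ofReal s) μ =
      ENNReal.ofReal (affineNorm l s c) := by
    intro s hs c
    rw [hX.eLpNorm_comp hl0 hl1 hs (fun x => 1 + c * x) (by fun_prop), affineNorm]
    congr 3
    ring_nf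
  simp only [IsHypercontractive, key hq, key hp, hmem, true_and]
  refine and_congr_right fun _ => and_congr_right fun _ => forall_congr' fun ρ => ?_
  exact ENNReal.ofReal_le_ofReal_iff (twoPointNorm_nonneg hl0 hl1 (abs_nonneg _) (abs_nonneg _))

/-! ### Two-point norms and the noise operator -/

lemma twoPointNorm_rpow {l s a b : ℝ} (hl0 : 0 < l) (hl1 : l < 1) (hs : s ≠ 0)
    (ha : 0 ≤ a) (hb : 0 ≤ b) : twoPointNorm l s a b ^ s = l * a ^ s + (1 - l) * b ^ s := by
  rw [twoPointNorm, ← Real.rpow_mul, one_div_mul_cancel hs, Real.rpow_one]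
  have := Real.rpow_nonneg ha s
  have := Real.rpow_nonneg hb s
  have : 0 < 1 - l := by linarith
  positivity

lemma twoPointNorm_mul {l s a b c : ℝ} (hl0 : 0 < l) (hl1 : l < 1) (hs : s ≠ 0)
    (hc : 0 ≤ c) (ha : 0 ≤ a) (hb : 0 ≤ b) :
    twoPointNorm l s (c * a) (c * b) = c * twoPointNorm l s a b := by
  have := Real.rpow_nonneg ha s
  have := Real.rpow_nonneg hb s
  have : 0 < 1 - l := by linarith
  have h : l * (c * a) ^ s + (1 - l) * (c * b) ^ s = c ^ s * (l * a ^ s + (1 - l) * b ^ s) := by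
    rw [Real.mul_rpow hc ha, Real.mul_rpow hc hb]; ring
  rw [twoPointNorm, twoPointNorm, h, Real.mul_rpow (by positivity) (by positivity),
    ← Real.rpow_mul hc, mul_one_div_cancel hs, Real.rpow_one]

lemma twoPointNorm_mono {l s a b a' b' : ℝ} (hl0 : 0 < l) (hl1 : l < 1) (hs : 0 < s)
    (ha : 0 ≤ a) (hb : 0 ≤ b) (haa : a ≤ a') (hbb : b ≤ b') :
    twoPointNorm l s a b ≤ twoPointNorm l s a' b' := by
  have := Real.rpow_nonneg ha s
  have := Real.rpow_nonneg hb s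
  have : 0 < 1 - l := by linarith
  unfold twoPointNorm
  gcongr

lemma twoPointNorm_le_iff {l s a b a' b' : ℝ} (hl0 : 0 < l) (hl1 : l < 1) (hs : 0 < s)
    (ha : 0 ≤ a) (hb : 0 ≤ b) (ha' : 0 ≤ a') (hb' : 0 ≤ b') :
    twoPointNorm l s a b ≤ twoPointNorm l s a' b' ↔
      l * a ^ s + (1 - l) * b ^ s ≤ l * a' ^ s + (1 - l) * b' ^ s := by
  rw [← twoPointNorm_rpow hl0 hl1 hs.ne' ha hb, ← twoPointNorm_rpow hl0 hl1 hs.ne' ha' hb']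
  exact (Real.rpow_le_rpow_iff (twoPointNorm_nonneg hl0 hl1 ha hb)
    (twoPointNorm_nonneg hl0 hl1 ha' hb') hs).symm

/-- Hölder's inequality on the two-point space. -/
lemma weighted_inner_le {l s t a b c d : ℝ} (hl0 : 0 < l) (hl1 : l < 1) (hst : s.HolderConjugate t)
    (ha : 0 ≤ a) (hb : 0 ≤ b) (hc : 0 ≤ c) (hd : 0 ≤ d) :
    l * (a * c) + (1 - l) * (b * d) ≤ twoPointNorm l s a b * twoPointNorm l t c d := by
  have h1l : 0 < 1 - l := by linarith
  have h := Real.inner_le_Lp_mul_Lq_of_nonneg (Finset.univ : Finset (Fin 2))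
    (f := ![l ^ (1 / s) * a, (1 - l) ^ (1 / s) * b])
    (g := ![l ^ (1 / t) * c, (1 - l) ^ (1 / t) * d]) hst
    (by intro i _; fin_cases i <;> simp <;> positivity)
    (by intro i _; fin_cases i <;> simp <;> positivity)
  simp only [Fin.sum_univ_two, Matrix.cons_val_zero, Matrix.cons_val_one] at h
  have e : ∀ {u w z : ℝ}, 0 < u → u ≠ 0 → 0 < w → 0 ≤ z → (w ^ (1 / u) * z) ^ u = w * z ^ u := by
    intro u w z _ hu hw hz
    rw [Real.mul_rpow (by positivity) hz, ← Real.rpow_mul hw.le, one_div_mul_cancel hu,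
      Real.rpow_one]
  have hs := hst.pos
  have ht := hst.symm.pos
  rw [e hs hs.ne' hl0 ha, e hs hs.ne' h1l hb, e ht ht.ne' hl0 hc, e ht ht.ne' h1l hd] at h
  have f : ∀ {w : ℝ}, 0 < w → w ^ (1 / s) * w ^ (1 / t) = w := by
    intro w hw
    rw [← Real.rpow_add hw, one_div, one_div, hst.inv_add_inv_eq_one, Real.rpow_one]
  calc l * (a * c) + (1 - l) * (b * d)
      = (l ^ (1 / s) * l ^ (1 / t)) * (a * c)
        + ((1 - l) ^ (1 / s) * (1 - l) ^ (1 / t)) * (b * d) := by rw [f hl0, f h1l]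
    _ = l ^ (1 / s) * a * (l ^ (1 / t) * c) + (1 - l) ^ (1 / s) * b * ((1 - l) ^ (1 / t) * d) := by
      ring
    _ ≤ _ := h

/-- The value on the atom of mass `l` of `T_r f = r f + (1 - r) 𝔼 f`, for `f = (a, b)`. -/
noncomputable def noiseFst (l r a b : ℝ) : ℝ := r * a + (1 - r) * (l * a + (1 - l) * b)
/-- The value on the atom of mass `1 - l` of `T_r f = r f + (1 - r) 𝔼 f`, for `f = (a, b)`. -/
noncomputable def noiseSnd (l r a b : ℝ) : ℝ := r * b + (1 - r) * (l * a + (1 - l) * b)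

lemma noiseFst_nonneg {l r a b : ℝ} (hl0 : 0 < l) (hl1 : l < 1) (hr0 : 0 ≤ r) (hr1 : r < 1)
    (ha : 0 ≤ a) (hb : 0 ≤ b) : 0 ≤ noiseFst l r a b := by
  have : 0 < 1 - l := by linarith
  have : 0 < 1 - r := by linarith
  unfold noiseFst; positivity

lemma noiseSnd_nonneg {l r a b : ℝ} (hl0 : 0 < l) (hl1 : l < 1) (hr0 : 0 ≤ r) (hr1 : r < 1)
    (ha : 0 ≤ a) (hb : 0 ≤ b) : 0 ≤ noiseSnd l r a b := by
  have : 0 < 1 - l := by linarith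
  have : 0 < 1 - r := by linarith
  unfold noiseSnd; positivity

lemma noiseSnd_le_noiseFst {l r a b : ℝ} (hr0 : 0 ≤ r) (hba : b ≤ a) :
    noiseSnd l r a b ≤ noiseFst l r a b := by
  unfold noiseFst noiseSnd; gcongr

/-- `‖T_r f‖_q ≤ ‖f‖_p` for the nonnegative function `f = (a, b)`. -/
def ContractsAt (l p q r a b : ℝ) : Prop :=
  twoPointNorm l q (noiseFst l r a b) (noiseSnd l r a b) ≤ twoPointNorm l p a b

/-- Duality, one function at a time: as `T_r` is self-adjoint, `‖T_r g‖_{p'} ≤ ‖g‖_{q'}` for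
`g = (a, b)` follows from the `L^p → L^q` bound at the single function `(T_r g)^(p' - 1)`. This
function has its larger value on the same atom as `g`, so the argument stays inside a cone. -/
lemma ContractsAt.dual {l p q p' q' r a b : ℝ} (hl0 : 0 < l) (hl1 : l < 1)
    (hr0 : 0 ≤ r) (hr1 : r < 1) (hp : p.HolderConjugate p') (hq : q.HolderConjugate q')
    (ha : 0 ≤ a) (hb : 0 ≤ b)
    (h : ContractsAt l p q r (noiseFst l r a b ^ (p' - 1)) (noiseSnd l r a b ^ (p' - 1))) :
    ContractsAt l q' p' r a b := by
  have h1l : 0 < 1 - l := by linarith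
  have hu := noiseFst_nonneg hl0 hl1 hr0 hr1 ha hb
  have hv := noiseSnd_nonneg hl0 hl1 hr0 hr1 ha hb
  unfold ContractsAt at *
  set u := noiseFst l r a b with hu'
  set v := noiseSnd l r a b with hv'
  have hfu := Real.rpow_nonneg hu (p' - 1)
  have hfv := Real.rpow_nonneg hv (p' - 1)
  set f := u ^ (p' - 1) with hf
  set g := v ^ (p' - 1) with hg
  have hp'1 := hp.symm.lt
  have hpp : (p' - 1) * p = p' := by have := hp.symm.sub_one_mul_conj; linarith
  have e : ∀ {z : ℝ}, 0 ≤ z → z * z ^ (p' - 1) = z ^ p' := by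
    intro z hz
    rw [mul_comm, ← Real.rpow_add_one' hz (by linarith)]; simp
  have hselfadj : l * (u * f) + (1 - l) * (v * g) =
      l * (noiseFst l r f g * a) + (1 - l) * (noiseSnd l r f g * b) := by
    rw [hu', hv']; unfold noiseFst noiseSnd; ring
  have hhol := weighted_inner_le hl0 hl1 hq (noiseFst_nonneg hl0 hl1 hr0 hr1 hfu hfv)
    (noiseSnd_nonneg hl0 hl1 hr0 hr1 hfu hfv) ha hb
  rw [← hselfadj, e hu, e hv] at hhol
  have hnf : twoPointNorm l p f g = (l * u ^ p' + (1 - l) * v ^ p') ^ (1 / p) := by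
    rw [twoPointNorm, hf, hg, ← Real.rpow_mul hu, ← Real.rpow_mul hv, hpp]
  have hE : 0 ≤ l * u ^ p' + (1 - l) * v ^ p' := by positivity
  have hN := twoPointNorm_nonneg (s := q') hl0 hl1 ha hb
  have hfin := hhol.trans (mul_le_mul_of_nonneg_right h hN)
  rw [hnf] at hfin
  rcases hE.eq_or_lt with h0 | h0
  · rw [twoPointNorm, ← h0, Real.zero_rpow (by simpa using hp.symm.ne_zero)]; exact hN
  · rw [twoPointNorm]
    have : (l * u ^ p' + (1 - l) * v ^ p') =
        (l * u ^ p' + (1 - l) * v ^ p') ^ (1 / p) * (l * u ^ p' + (1 - l) * v ^ p') ^ (1 / p') := by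
      rw [← Real.rpow_add h0, one_div, one_div, hp.inv_add_inv_eq_one, Real.rpow_one]
    nth_rewrite 1 [this] at hfin
    exact le_of_mul_le_mul_left hfin (by positivity)

/-- A nonnegative function of mean `m > 0` is `m (1 + ρ X)`, and `T_r` replaces `ρ` by `r ρ`. -/
lemma contractsAt_iff_affineNorm {l p q r m ρ : ℝ} (hl0 : 0 < l) (hl1 : l < 1) (hp : 0 < p)
    (hq : 0 < q) (hr0 : 0 ≤ r) (hr1 : r < 1) (hm : 0 < m) (h1 : 0 ≤ 1 + ρ * (1 - l))
    (h2 : 0 ≤ 1 - ρ * l) :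
    ContractsAt l p q r (m * (1 + ρ * (1 - l))) (m * (1 - ρ * l)) ↔
      affineNorm l q (r * ρ) ≤ affineNorm l p ρ := by
  have e1 : noiseFst l r (m * (1 + ρ * (1 - l))) (m * (1 - ρ * l)) =
    m * (1 + r * ρ * (1 - l)) := by unfold noiseFst; ring
  have e2 : noiseSnd l r (m * (1 + ρ * (1 - l))) (m * (1 - ρ * l)) =
    m * (1 - r * ρ * l) := by unfold noiseSnd; ring
  have h1' : 0 ≤ 1 + r * ρ * (1 - l) := by nlinarith
  have h2' : 0 ≤ 1 - r * ρ * l := by nlinarith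
  rw [ContractsAt, e1, e2, twoPointNorm_mul hl0 hl1 hq.ne' hm.le h1' h2',
    twoPointNorm_mul hl0 hl1 hp.ne' hm.le h1 h2, affineNorm, affineNorm, abs_of_nonneg h1,
    abs_of_nonneg h2, abs_of_nonneg h1', abs_of_nonneg h2']
  exact mul_le_mul_iff_right₀ hm

/-- Only nonnegative functions matter, because `|T_r f| ≤ T_r |f|`. -/
lemma affineNorm_le_of_forall_contractsAt {l p q r : ℝ} (hl0 : 0 < l) (hl1 : l < 1)
    (hq : 0 < q) (hr0 : 0 ≤ r) (hr1 : r < 1)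
    (h : ∀ a b, 0 ≤ a → 0 ≤ b → ContractsAt l p q r a b) (ρ : ℝ) :
    affineNorm l q (r * ρ) ≤ affineNorm l p ρ := by
  have h1l : 0 < 1 - l := by linarith
  refine le_trans ?_ (h _ _ (abs_nonneg (1 + ρ * (1 - l))) (abs_nonneg (1 - ρ * l)))
  have h1r : 0 < 1 - r := by linarith
  have key : ∀ u v w : ℝ, |r * u + (1 - r) * (l * v + (1 - l) * w)| ≤
      r * |u| + (1 - r) * (l * |v| + (1 - l) * |w|) := by
    intro u v w
    calc _ ≤ |r * u| + |(1 - r) * (l * v + (1 - l) * w)| := abs_add_le _ _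
      _ ≤ r * |u| + (1 - r) * (|l * v| + |(1 - l) * w|) := by
        rw [abs_mul, abs_mul, abs_of_nonneg hr0, abs_of_pos h1r]
        gcongr
        exact abs_add_le _ _
      _ = _ := by rw [abs_mul, abs_mul, abs_of_pos hl0, abs_of_pos h1l]
  refine twoPointNorm_mono hl0 hl1 hq (abs_nonneg _) (abs_nonneg _) ?_ ?_
  · refine le_trans (le_of_eq ?_) (key _ _ _)
    congr 1; ring
  · refine le_trans (le_of_eq ?_) (key _ _ _)
    congr 1; ring

/-! ### Negative slopes are dominated by positive ones -/

/-- The second derivatives of `v ↦ (r v + 1 - r)^q` and `v ↦ v^p` have, up to a constant factor,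
the ratio `(r v + 1 - r)^(q - 2) v^(2 - p)`, which is nondecreasing when `p ≤ 2` and `p < q`. -/
lemma noise_ratio_le {p q r c d : ℝ} (hp2 : p ≤ 2) (hpq : p < q)
    (hr0 : 0 < r) (hr1 : r < 1) (hc : 0 < c) (hcd : c < d) :
    (r * c + (1 - r)) ^ (q - 2) * d ^ (p - 2) ≤ (r * d + (1 - r)) ^ (q - 2) * c ^ (p - 2) := by
  have h1r : 0 < 1 - r := by linarith
  have hd : 0 < d := hc.trans hcd
  have hC : 0 < r * c + (1 - r) := by positivity
  have hD : 0 < r * d + (1 - r) := by positivity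
  have hCD : r * c + (1 - r) ≤ r * d + (1 - r) := by gcongr
  rcases le_total 2 q with hq | hq
  · exact mul_le_mul (Real.rpow_le_rpow hC.le hCD (by linarith))
      (Real.rpow_le_rpow_of_nonpos hc hcd.le (by linarith)) (by positivity) (by positivity)
  · -- write `w ^ (q - 2) = (w ^ (2 - q))⁻¹` and compare `v / (r v + 1 - r)` at `c` and `d`
    have h1 : (c * (r * d + (1 - r))) ^ (2 - q) ≤ (d * (r * c + (1 - r))) ^ (2 - q) :=
      Real.rpow_le_rpow (by positivity) (by nlinarith) (by linarith)
    have h2 : c ^ (q - p) ≤ d ^ (q - p) := Real.rpow_le_rpow hc.le hcd.le (by linarith)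
    rw [Real.mul_rpow hc.le hD.le, Real.mul_rpow hd.le hC.le] at h1
    have h3 := mul_le_mul h1 h2 (by positivity) (by positivity)
    have ec : c ^ (2 - q) * c ^ (q - p) = (c ^ (p - 2))⁻¹ := by
      rw [← Real.rpow_add hc, ← Real.rpow_neg hc.le]; congr 1; ring
    have ed : d ^ (2 - q) * d ^ (q - p) = (d ^ (p - 2))⁻¹ := by
      rw [← Real.rpow_add hd, ← Real.rpow_neg hd.le]; congr 1; ring
    have eC : (r * c + (1 - r)) ^ (2 - q) = ((r * c + (1 - r)) ^ (q - 2))⁻¹ := by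
      rw [← Real.rpow_neg hC.le]; congr 1; ring
    have eD : (r * d + (1 - r)) ^ (2 - q) = ((r * d + (1 - r)) ^ (q - 2))⁻¹ := by
      rw [← Real.rpow_neg hD.le]; congr 1; ring
    rw [mul_right_comm, ec, mul_right_comm, ed, eC, eD, ← mul_inv, ← mul_inv] at h3
    have := (inv_le_inv₀ (by positivity) (by positivity)).1 h3
    linarith

/-- For `1 < p ≤ 2` and `p < q` the functions `1, v, v^p, (r v + 1 - r)^q` behave like a Chebyshev
system: the interpolant of the last one by the first three at `x₁ < x₂ < x₃` lies below it at
every `x₄ > x₃`. -/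
lemma exists_interpolation {p q r x₁ x₂ x₃ x₄ : ℝ} (hp : 1 < p) (hp2 : p ≤ 2) (hpq : p < q)
    (hr0 : 0 < r) (hr1 : r < 1) (h1 : 0 ≤ x₁) (h12 : x₁ < x₂) (h23 : x₂ < x₃) (h34 : x₃ < x₄) :
    ∃ α β γ : ℝ, (r * x₁ + (1 - r)) ^ q = α * x₁ ^ p + β * x₁ + γ ∧
      (r * x₂ + (1 - r)) ^ q = α * x₂ ^ p + β * x₂ + γ ∧
      (r * x₃ + (1 - r)) ^ q = α * x₃ ^ p + β * x₃ + γ ∧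
      α * x₄ ^ p + β * x₄ + γ ≤ (r * x₄ + (1 - r)) ^ q := by
  have h1r : 0 < 1 - r := by linarith
  -- chord interpolation at `x₁`, `x₃`, then `α` is fixed by the value at `x₂`
  obtain ⟨α, β, γ, e1, e2, e3⟩ : ∃ α β γ : ℝ,
      (r * x₁ + (1 - r)) ^ q = α * x₁ ^ p + β * x₁ + γ ∧
      (r * x₂ + (1 - r)) ^ q = α * x₂ ^ p + β * x₂ + γ ∧
      (r * x₃ + (1 - r)) ^ q = α * x₃ ^ p + β * x₃ + γ := by
    have hconv : x₂ ^ p * (x₃ - x₁) < x₁ ^ p * (x₃ - x₂) + x₃ ^ p * (x₂ - x₁) := by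
      have h := (strictConvexOn_rpow hp).slope_strict_mono_adjacent (x := x₁) (y := x₂) (z := x₃)
        h1 (h1.trans (h12.trans h23).le) h12 h23
      rw [div_lt_div_iff₀ (by linarith) (by linarith)] at h
      nlinarith
    set g := fun v : ℝ => (r * v + (1 - r)) ^ q
    set h := fun v : ℝ => v ^ p
    have h13 : x₃ - x₁ ≠ 0 := by linarith
    have hD : h x₁ * (x₃ - x₂) + h x₃ * (x₂ - x₁) - h x₂ * (x₃ - x₁) ≠ 0 := by
      have : 0 < h x₁ * (x₃ - x₂) + h x₃ * (x₂ - x₁) - h x₂ * (x₃ - x₁) := by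
        simp only [h]; linarith
      exact this.ne'
    set α := (g x₁ * (x₃ - x₂) + g x₃ * (x₂ - x₁) - g x₂ * (x₃ - x₁)) /
      (h x₁ * (x₃ - x₂) + h x₃ * (x₂ - x₁) - h x₂ * (x₃ - x₁)) with hα
    set β := ((g x₃ - α * h x₃) - (g x₁ - α * h x₁)) / (x₃ - x₁) with hβ
    have hα' : α * (h x₁ * (x₃ - x₂) + h x₃ * (x₂ - x₁) - h x₂ * (x₃ - x₁)) =
      g x₁ * (x₃ - x₂) + g x₃ * (x₂ - x₁) - g x₂ * (x₃ - x₁) := div_mul_cancel₀ _ hD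
    have hβ' : β * (x₃ - x₁) = (g x₃ - α * h x₃) - (g x₁ - α * h x₁) := div_mul_cancel₀ _ h13
    clear_value α β
    refine ⟨α, β, g x₁ - α * h x₁ - β * x₁, ?_, ?_, ?_⟩
    · change g x₁ = α * h x₁ + _ + _; ring
    · change g x₂ = α * h x₂ + _ + _
      apply mul_right_cancel₀ h13
      linear_combination hα' - (x₂ - x₁) * hβ'
    · change g x₃ = α * h x₃ + _ + _
      linear_combination -hβ'
  refine ⟨α, β, γ, e1, e2, e3, ?_⟩
  -- otherwise Rolle, applied twice to the difference `φ`, contradicts `noise_ratio_le`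
  by_contra! h4
  set φ : ℝ → ℝ := fun v => (r * v + (1 - r)) ^ q - (α * v ^ p + β * v + γ) with hφ
  set φ' : ℝ → ℝ := fun v => q * r * (r * v + (1 - r)) ^ (q - 1) - (α * (p * v ^ (p - 1)) + β)
    with hφ'
  have hder : ∀ v, 0 < v → HasDerivAt φ (φ' v) v := by
    intro v hv
    have hV : 0 < r * v + (1 - r) := by positivity
    have d1 : HasDerivAt (fun v : ℝ => r * v + (1 - r)) r v := by
      simpa using ((hasDerivAt_id v).const_mul r).add_const (1 - r)
    have d2 := d1.rpow_const (p := q) (Or.inl hV.ne')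
    have d3 := ((Real.hasDerivAt_rpow_const (x := v) (p := p) (Or.inl hv.ne')).const_mul α).add
      ((hasDerivAt_id v).const_mul β) |>.add_const γ
    refine (d2.sub d3).congr_deriv ?_
    simp only [hφ']; ring
  have hder' : ∀ v, 0 < v → HasDerivAt φ' (q * r * ((q - 1) * r * (r * v + (1 - r)) ^ (q - 2)) -
      α * (p * ((p - 1) * v ^ (p - 2)))) v := by
    intro v hv
    have hV : 0 < r * v + (1 - r) := by positivity
    have d1 : HasDerivAt (fun v : ℝ => r * v + (1 - r)) r v := by
      simpa using ((hasDerivAt_id v).const_mul r).add_const (1 - r)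
    have d2 := (d1.rpow_const (p := q - 1) (Or.inl hV.ne')).const_mul (q * r)
    have d3 := (((Real.hasDerivAt_rpow_const (x := v) (p := p - 1)
      (Or.inl hv.ne')).const_mul p).const_mul α).add_const β
    refine (d2.sub d3).congr_deriv ?_
    rw [show q - 1 - 1 = q - 2 by ring, show p - 1 - 1 = p - 2 by ring]; ring
  have hcont : ContinuousOn φ (Set.Ici 0) := by
    intro v hv
    have hV : 0 < r * v + (1 - r) := by have := Set.mem_Ici.1 hv; positivity
    apply ContinuousAt.continuousWithinAt
    refine ContinuousAt.sub (ContinuousAt.rpow_const (by fun_prop) (Or.inl hV.ne')) ?_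
    refine ContinuousAt.add (ContinuousAt.add (continuousAt_const.mul
      (Real.continuousAt_rpow_const _ _ (Or.inr (by linarith)))) (by fun_prop)) (by fun_prop)
  have mvt : ∀ u v, 0 ≤ u → u < v → ∃ c ∈ Set.Ioo u v, φ' c = (φ v - φ u) / (v - u) := by
    intro u v hu huv
    exact exists_hasDerivAt_eq_slope φ φ' huv
      (hcont.mono fun z hz => hu.trans hz.1) fun z hz => hder z (hu.trans_lt hz.1)
  have z1 : φ x₁ = 0 := by simp only [hφ]; linarith
  have z2 : φ x₂ = 0 := by simp only [hφ]; linarith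
  have z3 : φ x₃ = 0 := by simp only [hφ]; linarith
  have z4 : φ x₄ < 0 := by simp only [hφ]; linarith
  obtain ⟨c₁, hc₁, k1⟩ := mvt x₁ x₂ h1 h12
  obtain ⟨c₂, hc₂, k2⟩ := mvt x₂ x₃ (by linarith) h23
  obtain ⟨c₃, hc₃, k3⟩ := mvt x₃ x₄ (by linarith) h34
  have hc1 : 0 < c₁ := h1.trans_lt hc₁.1
  have hc12 : c₁ < c₂ := hc₁.2.trans hc₂.1
  have hc23 : c₂ < c₃ := hc₂.2.trans hc₃.1
  rw [z1, z2, sub_self, zero_div] at k1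
  rw [z2, z3, sub_self, zero_div] at k2
  rw [z3] at k3
  have k3' : φ' c₃ < 0 := by
    rw [k3]; exact div_neg_of_neg_of_pos (by linarith) (by linarith)
  have mvt' : ∀ u v, 0 < u → u < v → ∃ d ∈ Set.Ioo u v,
      q * r * ((q - 1) * r * (r * d + (1 - r)) ^ (q - 2)) - α * (p * ((p - 1) * d ^ (p - 2))) =
        (φ' v - φ' u) / (v - u) := by
    intro u v hu huv
    refine exists_hasDerivAt_eq_slope φ' _ huv
      (fun z hz => (hder' z (hu.trans_le hz.1)).continuousAt.continuousWithinAt)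
      fun z hz => hder' z (hu.trans hz.1)
  obtain ⟨d₁, hd₁, m1⟩ := mvt' c₁ c₂ hc1 hc12
  obtain ⟨d₂, hd₂, m2⟩ := mvt' c₂ c₃ (hc1.trans hc12) hc23
  have hd1 : 0 < d₁ := hc1.trans hd₁.1
  have hd12 : d₁ < d₂ := hd₁.2.trans hd₂.1
  have hd2 : 0 < d₂ := hd1.trans hd12
  rw [k1, k2] at m1
  rw [k2] at m2
  have m2' : q * r * ((q - 1) * r * (r * d₂ + (1 - r)) ^ (q - 2)) -
      α * (p * ((p - 1) * d₂ ^ (p - 2))) < 0 := by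
    rw [m2]; exact div_neg_of_neg_of_pos (by simpa using k3') (by linarith)
  have hmono := noise_ratio_le hp2 hpq hr0 hr1 hd1 hd12
  have P1 : 0 < d₁ ^ (p - 2) := by positivity
  have P2 : 0 < d₂ ^ (p - 2) := by positivity
  have hq : 0 < q * r * ((q - 1) * r) :=
    mul_pos (mul_pos (by linarith) hr0) (mul_pos (by linarith) hr0)
  have a1 := mul_lt_mul_of_pos_right m2' P1
  have a2 := mul_le_mul_of_nonneg_left hmono hq.le
  have m1' : q * r * ((q - 1) * r * (r * d₁ + (1 - r)) ^ (q - 2)) =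
      α * (p * ((p - 1) * d₁ ^ (p - 2))) := by
    rw [sub_self, zero_div] at m1; linarith
  have : (0 : ℝ) < 0 := by linear_combination a1 + a2 - d₂ ^ (p - 2) * m1'
  exact lt_irrefl _ this

/-- Two-atom laws of the same mean: the one on the endpoints of an interval has a larger integral
of a strictly convex function than the one on points of that interval. -/
lemma StrictConvexOn.two_point_lt {h : ℝ → ℝ} {s : Set ℝ} (hh : StrictConvexOn ℝ s h)
    {x y z₁ z₂ c₁ c₂ d₁ d₂ : ℝ} (hx : x ∈ s) (hy : y ∈ s) (hz1 : x ≤ z₁) (hz1' : z₁ ≤ y)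
    (hz2 : x < z₂) (hz2' : z₂ < y) (hc1 : 0 ≤ c₁) (hc2 : 0 < c₂) (hc : c₁ + c₂ = 1)
    (hd : d₁ + d₂ = 1) (hmean : c₁ * z₁ + c₂ * z₂ = d₁ * x + d₂ * y) :
    c₁ * h z₁ + c₂ * h z₂ < d₁ * h x + d₂ * h y := by
  have hxy : 0 < y - x := by linarith
  have k1 : h z₁ * (y - x) ≤ (y - z₁) * h x + (z₁ - x) * h y := by
    have := hh.convexOn.2 hx hy (div_nonneg (by linarith) hxy.le : 0 ≤ (y - z₁) / (y - x))
      (div_nonneg (by linarith) hxy.le : 0 ≤ (z₁ - x) / (y - x))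
      (by field_simp; ring)
    simp only [smul_eq_mul] at this
    rw [show (y - z₁) / (y - x) * x + (z₁ - x) / (y - x) * y = z₁ by field_simp; ring] at this
    calc _ ≤ ((y - z₁) / (y - x) * h x + (z₁ - x) / (y - x) * h y) * (y - x) := by gcongr
      _ = _ := by field_simp
  have k2 : h z₂ * (y - x) < (y - z₂) * h x + (z₂ - x) * h y := by
    have := hh.2 hx hy (by linarith : x ≠ y) (div_pos (by linarith) hxy : 0 < (y - z₂) / (y - x))
      (div_pos (by linarith) hxy : 0 < (z₂ - x) / (y - x))
      (by field_simp; ring)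
    simp only [smul_eq_mul] at this
    rw [show (y - z₂) / (y - x) * x + (z₂ - x) / (y - x) * y = z₂ by field_simp; ring] at this
    calc _ < ((y - z₂) / (y - x) * h x + (z₂ - x) / (y - x) * h y) * (y - x) := by gcongr
      _ = _ := by field_simp
  have k := add_lt_add_of_le_of_lt (mul_le_mul_of_nonneg_left k1 hc1)
    (mul_lt_mul_of_pos_left k2 hc2)
  refine lt_of_mul_lt_mul_right (lt_of_lt_of_eq (lt_of_eq_of_lt ?_ k) ?_) hxy.le
  · ring
  · have e1 : d₁ = 1 - d₂ := by linarith
    have e2 : c₁ = 1 - c₂ := by linarith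
    subst e1 e2
    linear_combination (h y - h x) * hmean

/-- Each function `1 - t X ≥ 0` of negative slope has a partner `1 + u X ≥ 0` of positive slope
with the same mean and the same `p`-th moment, whose image under `T_r` has at least the same
`q`-th moment. The signed difference of the two laws has four atoms of alternating sign and
annihilates `1, v, v^p`, so `exists_interpolation` decides the sign of its integral of
`(r v + 1 - r)^q`. -/
lemma exists_reflected_dominating {l p q r t : ℝ} (hl0 : 0 < l) (hl1 : l < 1 / 2) (hp : 1 < p)
    (hp2 : p ≤ 2) (hpq : p < q) (hr0 : 0 < r) (hr1 : r < 1) (ht : 0 < t)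
    (ht1 : t * (1 - l) ≤ 1) :
    ∃ u, 0 < u ∧ u * l ≤ 1 ∧
      l * (1 + u * (1 - l)) ^ p + (1 - l) * (1 - u * l) ^ p =
        l * (1 - t * (1 - l)) ^ p + (1 - l) * (1 + t * l) ^ p ∧
      l * (1 - r * t * (1 - l)) ^ q + (1 - l) * (1 + r * t * l) ^ q ≤
        l * (1 + r * u * (1 - l)) ^ q + (1 - l) * (1 - r * u * l) ^ q := by
  have h1l : 0 < 1 - l := by linarith
  have hp0 : 0 < p := by linarith
  set K := l * (1 - t * (1 - l)) ^ p + (1 - l) * (1 + t * l) ^ p with hK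
  have hconv := strictConvexOn_rpow hp
  have hlow : 1 ≤ K := by
    have b1 := one_add_mul_self_le_rpow_one_add (s := -(t * (1 - l))) (by linarith) hp.le
    have b2 := one_add_mul_self_le_rpow_one_add (s := t * l) (by nlinarith) hp.le
    rw [← sub_eq_add_neg] at b1
    nlinarith
  have hhigh : K < l * (1 / l) ^ p := by
    have := hconv.two_point_lt (x := 0) (y := 1 / l) (z₁ := 1 - t * (1 - l)) (z₂ := 1 + t * l)
      (c₁ := l) (c₂ := 1 - l) (d₁ := 1 - l) (d₂ := l) Set.self_mem_Ici
      (by simp [hl0.le]) (by linarith)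
      (by rw [le_div_iff₀ hl0]; nlinarith [mul_pos ht h1l]) (by positivity)
      (by rw [lt_div_iff₀ hl0]; nlinarith [mul_pos ht h1l, mul_pos ht hl0])
      hl0.le h1l (by ring) (by ring)
      (by field_simp; ring)
    rw [Real.zero_rpow hp0.ne'] at this
    simpa [hK] using this
  have hcont : ContinuousOn (fun u : ℝ => l * (1 + u * (1 - l)) ^ p + (1 - l) * (1 - u * l) ^ p)
      (Set.Icc 0 (1 / l)) := by
    apply Continuous.continuousOn
    have := Real.continuous_rpow_const hp0.le
    exact (continuous_const.mul (this.comp (by fun_prop))).add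
      (continuous_const.mul (this.comp (by fun_prop)))
  -- by the intermediate value theorem the `p`-th moment `K` is attained on the positive side
  obtain ⟨u, hu, huK⟩ : K ∈ (fun u : ℝ => l * (1 + u * (1 - l)) ^ p + (1 - l) * (1 - u * l) ^ p) ''
      (Set.Icc 0 (1 / l)) := by
    apply intermediate_value_Icc (by positivity) hcont
    constructor
    · simpa using hlow
    · have e : 1 + 1 / l * (1 - l) = 1 / l := by field_simp; ring
      have e' : 1 - 1 / l * l = 0 := by field_simp; ring
      simp only [e, e', Real.zero_rpow hp0.ne']
      simpa using hhigh.le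
  simp only at huK
  have hul : u * l ≤ 1 := by have := hu.2; rwa [le_div_iff₀ hl0] at this
  -- the four atoms are ordered `1 - t (1 - l) < 1 - u l < 1 + t l < 1 + u (1 - l)`
  have hord1 : u * l < t * (1 - l) := by
    by_contra! hc
    have hu0 : 0 < u := by
      by_contra! h
      nlinarith [mul_pos ht h1l]
    have : t * l < u * (1 - l) := by nlinarith [mul_pos ht h1l, mul_pos ht hl0]
    have := hconv.two_point_lt (x := 1 - u * l) (y := 1 + u * (1 - l)) (z₁ := 1 - t * (1 - l))
      (z₂ := 1 + t * l) (c₁ := l) (c₂ := 1 - l) (d₁ := 1 - l) (d₂ := l)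
      (by simp [hul]) (by simp; nlinarith)
      (by linarith) (by nlinarith [mul_pos ht h1l])
      (by nlinarith [mul_pos ht hl0]) (by linarith) hl0.le h1l (by ring) (by ring) (by ring)
    rw [hK] at huK
    linarith
  have hord2 : t * l < u * (1 - l) := by
    by_contra! hc
    have := hconv.two_point_lt (x := 1 - t * (1 - l)) (y := 1 + t * l) (z₁ := 1 + u * (1 - l))
      (z₂ := 1 - u * l) (c₁ := l) (c₂ := 1 - l) (d₁ := l) (d₂ := 1 - l)
      (by simp [ht1]) (by simp; nlinarith)
      (by nlinarith [hu.1, mul_pos ht h1l]) (by linarith)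
      (by linarith) (by nlinarith [hu.1, mul_pos ht hl0]) hl0.le h1l (by ring) (by ring) (by ring)
    rw [hK] at huK
    linarith
  have hu0 : 0 < u := by
    by_contra! h
    nlinarith [mul_pos ht hl0]
  refine ⟨u, hu0, hul, huK, ?_⟩
  obtain ⟨α, β, γ, e1, e2, e3, e4⟩ := exists_interpolation (x₁ := 1 - t * (1 - l))
    (x₂ := 1 - u * l) (x₃ := 1 + t * l) (x₄ := 1 + u * (1 - l)) hp hp2 hpq hr0 hr1 (by linarith)
    (by linarith) (by nlinarith [mul_pos hu0 hl0, mul_pos ht hl0]) (by linarith)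
  rw [show r * (1 - t * (1 - l)) + (1 - r) = 1 - r * t * (1 - l) by ring] at e1
  rw [show r * (1 - u * l) + (1 - r) = 1 - r * u * l by ring] at e2
  rw [show r * (1 + t * l) + (1 - r) = 1 + r * t * l by ring] at e3
  rw [show r * (1 + u * (1 - l)) + (1 - r) = 1 + r * u * (1 - l) by ring] at e4
  have e4' := mul_le_mul_of_nonneg_left e4 hl0.le
  rw [e1, e2, e3]
  rw [hK] at huK
  linear_combination e4' - α * huK

lemma contractsAt_of_cone_of_le_two {l p q r : ℝ} (hl0 : 0 < l) (hl1 : l < 1 / 2) (hp : 1 < p)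
    (hp2 : p ≤ 2) (hpq : p < q) (hr0 : 0 < r) (hr1 : r < 1)
    (h : ∀ a b, 0 ≤ b → b ≤ a → ContractsAt l p q r a b) {a b : ℝ} (ha : 0 ≤ a) (hb : 0 ≤ b) :
    ContractsAt l p q r a b := by
  rcases le_or_gt b a with hba | hab
  · exact h a b hb hba
  have h1l : 0 < 1 - l := by linarith
  have hl1' : l < 1 := by linarith
  have hp0 : 0 < p := by linarith
  have hq0 : 0 < q := by linarith
  have hm : 0 < l * a + (1 - l) * b := by nlinarith [mul_nonneg hl0.le ha]
  set m := l * a + (1 - l) * b with hmdef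
  set t := (b - a) / m with ht
  have htm : t * m = b - a := div_mul_cancel₀ _ hm.ne'
  have ht0 : 0 < t := div_pos (by linarith) hm
  have ea : a = m * (1 + (-t) * (1 - l)) := by rw [hmdef] at *; linear_combination (1 - l) * htm
  have eb : b = m * (1 - (-t) * l) := by rw [hmdef] at *; linear_combination -l * htm
  have ht1 : t * (1 - l) ≤ 1 := by
    rw [ea] at ha
    have := nonneg_of_mul_nonneg_right ha hm
    linarith
  have hrt : r * t ≤ t := by nlinarith
  have hrt' : r * t * (1 - l) ≤ 1 := by nlinarith
  obtain ⟨u, hu0, hu1, hup, huq⟩ :=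
    exists_reflected_dominating hl0 hl1 hp hp2 hpq hr0 hr1 ht0 ht1
  have hru : r * u * l ≤ 1 := by nlinarith [mul_pos hu0 hl0]
  have hu := h (1 * (1 + u * (1 - l))) (1 * (1 - u * l)) (by linarith) (by nlinarith)
  rw [contractsAt_iff_affineNorm hl0 hl1' hp0 hq0 hr0.le hr1 one_pos (by positivity)
    (by linarith)] at hu
  rw [ea, eb, contractsAt_iff_affineNorm hl0 hl1' hp0 hq0 hr0.le hr1 hm (by linarith)
    (by nlinarith)]
  have pos1 : 0 ≤ 1 + r * u * (1 - l) := by positivity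
  have pos2 : 0 ≤ 1 + u * (1 - l) := by positivity
  have pos3 : 0 ≤ 1 + r * t * l := by positivity
  have pos4 : 0 ≤ 1 + t * l := by positivity
  unfold affineNorm at *
  rw [abs_of_nonneg (by linarith), abs_of_nonneg (by linarith), abs_of_nonneg (by linarith),
    abs_of_nonneg (by linarith)] at hu ⊢
  calc twoPointNorm l q (1 + r * -t * (1 - l)) (1 - r * -t * l)
      ≤ twoPointNorm l q (1 + r * u * (1 - l)) (1 - r * u * l) := by
        rw [twoPointNorm_le_iff hl0 hl1' hq0 (by linarith) (by linarith) (by linarith)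
          (by linarith)]
        convert huq using 4 <;> ring
    _ ≤ _ := hu
    _ = twoPointNorm l p (1 + -t * (1 - l)) (1 - -t * l) := by
        unfold twoPointNorm
        rw [hup, show 1 + -t * (1 - l) = 1 - t * (1 - l) by ring,
          show 1 - -t * l = 1 + t * l by ring]

/-- The bound on the cone `b ≤ a` implies the bound for all nonnegative functions. For `p > 2` the
comparison of moments does not apply directly, but it applies to the dual pair `(q', p')`, which
has `q' < 2`, and duality preserves the cone. -/
lemma contractsAt_of_cone {l p q r : ℝ} (hl0 : 0 < l) (hl1 : l < 1 / 2) (hp : 1 < p)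
    (hpq : p < q) (hr0 : 0 < r) (hr1 : r < 1)
    (h : ∀ a b, 0 ≤ b → b ≤ a → ContractsAt l p q r a b) {a b : ℝ} (ha : 0 ≤ a) (hb : 0 ≤ b) :
    ContractsAt l p q r a b := by
  rcases le_total p 2 with hp2 | hp2
  · exact contractsAt_of_cone_of_le_two hl0 hl1 hp hp2 hpq hr0 hr1 h ha hb
  have hl1' : l < 1 := by linarith
  have hP := Real.HolderConjugate.conjExponent hp
  have hQ := Real.HolderConjugate.conjExponent (hp.trans hpq)
  set p' := p.conjExponent with hp'
  set q' := q.conjExponent with hq'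
  have hq'2 : q' ≤ 2 := by
    rw [hq', Real.conjExponent, div_le_iff₀ (by linarith)]; linarith
  have hqp : q' < p' := by
    rw [hq', hp', Real.conjExponent, Real.conjExponent, div_lt_div_iff₀ (by linarith) (by linarith)]
    linarith
  have hcone : ∀ a b, 0 ≤ b → b ≤ a → ContractsAt l q' p' r a b := by
    intro a b hb hba
    have hv := noiseSnd_nonneg hl0 hl1' hr0.le hr1 (hb.trans hba) hb
    refine ContractsAt.dual hl0 hl1' hr0.le hr1 hP hQ (hb.trans hba) hb (h _ _ ?_ ?_)
    · exact Real.rpow_nonneg hv _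
    · exact Real.rpow_le_rpow hv (noiseSnd_le_noiseFst hr0.le hba) hP.symm.sub_one_pos.le
  refine ContractsAt.dual hl0 hl1' hr0.le hr1 hQ.symm hP.symm ha hb ?_
  exact contractsAt_of_cone_of_le_two hl0 hl1 hQ.symm.lt hq'2 hqp hr0 hr1 hcone
    (Real.rpow_nonneg (noiseFst_nonneg hl0 hl1' hr0.le hr1 ha hb) _)
    (Real.rpow_nonneg (noiseSnd_nonneg hl0 hl1' hr0.le hr1 ha hb) _)

lemma one_le_affineNorm {l p ρ : ℝ} (hl0 : 0 < l) (hl1 : l < 1) (hp : 1 ≤ p) :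
    1 ≤ affineNorm l p ρ := by
  have h1l : 0 < 1 - l := by linarith
  refine Real.one_le_rpow ?_ (by positivity)
  have key : ∀ v : ℝ, 1 + p * (v - 1) ≤ |v| ^ p := fun v => by
    have := one_add_mul_self_le_rpow_one_add (s := |v| - 1) (by linarith [abs_nonneg v]) hp
    rw [add_sub_cancel] at this
    nlinarith [le_abs_self v]
  have k1 := mul_le_mul_of_nonneg_left (key (1 + ρ * (1 - l))) hl0.le
  have k2 := mul_le_mul_of_nonneg_left (key (1 - ρ * l)) h1l.le
  nlinarith

lemma affineNorm_zero {l p : ℝ} : affineNorm l p 0 = 1 := by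
  simp [affineNorm, twoPointNorm]

/-- Hypercontractivity has to be tested only for `0 ≤ ρ ≤ 1 / l`, where `1 + ρ X` is nonnegative
and largest on the small atom. -/
lemma affineNorm_le_of_forall_mem_Icc {l p q r : ℝ} (hl0 : 0 < l) (hl1 : l < 1 / 2) (hp : 1 < p)
    (hpq : p < q) (hr0 : 0 ≤ r) (hr1 : r < 1)
    (h : ∀ ρ ∈ Set.Icc 0 (1 / l), affineNorm l q (r * ρ) ≤ affineNorm l p ρ) (ρ : ℝ) :
    affineNorm l q (r * ρ) ≤ affineNorm l p ρ := by
  have hl1' : l < 1 := by linarith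
  rcases hr0.eq_or_lt with rfl | hr0
  · rw [zero_mul, affineNorm_zero]; exact one_le_affineNorm hl0 hl1' hp.le
  refine affineNorm_le_of_forall_contractsAt hl0 hl1' (by linarith) hr0.le hr1
    (fun a b ha hb => contractsAt_of_cone hl0 hl1 hp hpq hr0 hr1 ?_ ha hb) ρ
  intro a b hb hba
  have h1l : 0 < 1 - l := by linarith
  rcases (add_nonneg (mul_nonneg hl0.le (hb.trans hba)) (mul_nonneg h1l.le hb)).eq_or_lt with
    hm | hm
  · have hb0 : b = 0 := by nlinarith [mul_nonneg hl0.le (hb.trans hba)]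
    have ha0 : a = 0 := by nlinarith
    subst ha0 hb0
    have hp0 : p ≠ 0 := by linarith
    have hq0 : q ≠ 0 := by linarith
    simp [ContractsAt, noiseFst, noiseSnd, twoPointNorm, hp0, hq0]
  set m := l * a + (1 - l) * b with hmdef
  set t := (a - b) / m with ht
  have htm : t * m = a - b := div_mul_cancel₀ _ hm.ne'
  have ht0 : 0 ≤ t := div_nonneg (by linarith) hm.le
  have ea : a = m * (1 + t * (1 - l)) := by rw [hmdef] at *; linear_combination -(1 - l) * htm
  have eb : b = m * (1 - t * l) := by rw [hmdef] at *; linear_combination l * htm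
  have htl : t ≤ 1 / l := by
    rw [eb] at hb
    have := nonneg_of_mul_nonneg_right hb hm
    rw [le_div_iff₀ hl0]; linarith
  rw [ea, eb, contractsAt_iff_affineNorm hl0 hl1' (by linarith) (by linarith) hr0.le hr1 hm
    (by positivity) (by rw [le_div_iff₀ hl0] at htl; linarith)]
  exact h t ⟨ht0, htl⟩

/-! ### Expansion at the constant function -/

lemma one_add_rpow_sub_isBigO (s : ℝ) :
    (fun z : ℝ => (1 + z) ^ s - (1 + s * z + s * (s - 1) / 2 * z ^ 2 +
      s * (s - 1) * (s - 2) / 6 * z ^ 3)) =O[nhds 0] fun z => z ^ 4 := by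
  have h := (Real.one_add_rpow_hasFPowerSeriesAt_zero (a := s)).isBigO_sub_partialSum_pow 4
  have h3 : Ring.choose s 3 = s * (s - 1) * (s - 2) / 6 := by
    rw [Ring.choose_eq_smul]
    have h2 : (2 : Polynomial ℤ).smeval s = 2 := by
      simpa using Polynomial.smeval_natCast (R := ℤ) s 2
    simp [descPochhammer_succ_right, Polynomial.smeval_sub, Polynomial.smeval_mul,
      Polynomial.smeval_X, Nat.factorial, h2]
    ring
  have h2 : Ring.choose s 2 = s * (s - 1) / 2 := by
    rw [Ring.choose_eq_smul]
    simp [descPochhammer_succ_right, Polynomial.smeval_sub, Polynomial.smeval_mul,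
      Polynomial.smeval_X, Nat.factorial]
    ring
  refine (h.congr_left ?_).trans ?_
  · intro z
    simp [FormalMultilinearSeries.partialSum, Finset.sum_range_succ, h2, h3,
      -FormalMultilinearSeries.apply_eq_prod_smul_coeff]
  · exact Asymptotics.IsBigO.of_bound 1 (Filter.Eventually.of_forall fun z => by simp)

lemma one_add_rpow_sub_linear_isBigO (s : ℝ) :
    (fun z : ℝ => (1 + z) ^ s - (1 + s * z)) =O[nhds 0] fun z => z ^ 2 := by
  have h := (Real.one_add_rpow_hasFPowerSeriesAt_zero (a := s)).isBigO_sub_partialSum_pow 2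
  refine (h.congr_left ?_).trans ?_
  · intro z
    simp [FormalMultilinearSeries.partialSum, Finset.sum_range_succ,
      -FormalMultilinearSeries.apply_eq_prod_smul_coeff]
  · exact Asymptotics.IsBigO.of_bound 1 (Filter.Eventually.of_forall fun z => by simp)

lemma isBigO_pow_of_le {m n : ℕ} (h : m ≤ n) :
    (fun z : ℝ => z ^ n) =O[nhds 0] fun z : ℝ => z ^ m := by
  refine Asymptotics.IsBigO.of_bound 1 ?_
  filter_upwards [Metric.ball_mem_nhds (0 : ℝ) one_pos] with z hz
  rw [Metric.mem_ball, dist_zero_right] at hz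
  rw [norm_pow, norm_pow, one_mul]
  exact pow_le_pow_of_le_one (norm_nonneg _) hz.le h

/-- `‖1 + ρ X‖_s` to third order; the second and third moments of `X` are `l (1 - l)` and
`l (1 - l) (1 - 2 l)`. -/
lemma affineNorm_sub_isBigO {l s : ℝ} (hs : 0 < s) :
    (fun ρ : ℝ => affineNorm l s ρ - (1 + (s - 1) / 2 * (l * (1 - l)) * ρ ^ 2 +
      (s - 1) * (s - 2) / 6 * (l * (1 - l) * (1 - 2 * l)) * ρ ^ 3)) =O[nhds 0] fun ρ => ρ ^ 4 := by
  have hlin : ∀ c : ℝ, Filter.Tendsto (fun ρ : ℝ => ρ * c) (nhds 0) (nhds 0) := fun c => by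
    have : Continuous fun ρ : ℝ => ρ * c := by fun_prop
    simpa using this.tendsto 0
  have hexp : ∀ c : ℝ, (fun ρ : ℝ => (1 + ρ * c) ^ s - (1 + s * (ρ * c) +
      s * (s - 1) / 2 * (ρ * c) ^ 2 + s * (s - 1) * (s - 2) / 6 * (ρ * c) ^ 3))
      =O[nhds 0] fun ρ => ρ ^ 4 := fun c =>
    ((one_add_rpow_sub_isBigO s).comp_tendsto (hlin c)).trans <|
      Asymptotics.IsBigO.of_bound (|c| ^ 4) (Filter.Eventually.of_forall fun z => by
        simp [mul_pow, mul_comm])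
  -- `u` is the `s`-th moment minus one
  set u : ℝ → ℝ := fun ρ => l * (1 + ρ * (1 - l)) ^ s + (1 - l) * (1 + ρ * (-l)) ^ s - 1 with hu
  have hu4 : (fun ρ => u ρ - (s * (s - 1) / 2 * (l * (1 - l)) * ρ ^ 2 +
      s * (s - 1) * (s - 2) / 6 * (l * (1 - l) * (1 - 2 * l)) * ρ ^ 3))
      =O[nhds 0] fun ρ => ρ ^ 4 := by
    refine (((hexp (1 - l)).const_mul_left l).add ((hexp (-l)).const_mul_left (1 - l))).congr_left
      fun ρ => ?_
    simp only [hu]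
    ring
  have hu2 : u =O[nhds 0] fun ρ => ρ ^ 2 := by
    have h2 : (fun ρ : ℝ => s * (s - 1) / 2 * (l * (1 - l)) * ρ ^ 2 +
        s * (s - 1) * (s - 2) / 6 * (l * (1 - l) * (1 - 2 * l)) * ρ ^ 3)
        =O[nhds 0] fun ρ : ℝ => ρ ^ 2 :=
      ((Asymptotics.isBigO_refl _ _).const_mul_left _).add
        ((isBigO_pow_of_le (by norm_num)).const_mul_left _)
    exact ((hu4.trans (isBigO_pow_of_le (by norm_num))).add h2).congr_left fun ρ => by ring
  have hu0 : Filter.Tendsto u (nhds 0) (nhds 0) := by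
    refine hu2.trans_tendsto ?_
    have : Continuous fun ρ : ℝ => ρ ^ 2 := by fun_prop
    simpa using this.tendsto 0
  have hroot : (fun ρ => (1 + u ρ) ^ (1 / s) - (1 + 1 / s * u ρ)) =O[nhds 0] fun ρ => ρ ^ 4 :=
    ((one_add_rpow_sub_linear_isBigO (1 / s)).comp_tendsto hu0).trans
      ((hu2.pow 2).congr_right fun ρ => by ring)
  refine (hroot.add (hu4.const_mul_left (1 / s))).congr' ?_ Filter.EventuallyEq.rfl
  have e1 : ∀ᶠ ρ in nhds (0 : ℝ), |ρ * (1 - l)| < 1 :=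
    (hlin (1 - l)).abs.eventually_lt_const (by simp)
  have e2 : ∀ᶠ ρ in nhds (0 : ℝ), |ρ * l| < 1 :=
    (hlin l).abs.eventually_lt_const (by simp)
  filter_upwards [e1, e2] with ρ h1 h2
  rw [affineNorm, twoPointNorm, abs_of_nonneg (by linarith [(abs_lt.1 h1).1]),
    abs_of_nonneg (by linarith [(abs_lt.1 h2).2])]
  have : 1 + u ρ = l * (1 + ρ * (1 - l)) ^ s + (1 - l) * (1 - ρ * l) ^ s := by
    simp only [hu, mul_neg, ← sub_eq_add_neg]; ring
  rw [this]
  field_simp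
  ring

lemma affineNorm_diff_isBigO {l p q r : ℝ} (hp : 0 < p) (hq : 0 < q) :
    (fun ρ : ℝ => (affineNorm l p ρ - affineNorm l q (r * ρ)) -
      (((p - 1) - (q - 1) * r ^ 2) * (l * (1 - l) / 2) * ρ ^ 2 +
       ((p - 1) * (p - 2) - (q - 1) * (q - 2) * r ^ 3) * (l * (1 - l) * (1 - 2 * l) / 6) * ρ ^ 3))
      =O[nhds 0] fun ρ => ρ ^ 4 := by
  have hlin : Filter.Tendsto (fun ρ : ℝ => r * ρ) (nhds 0) (nhds 0) := by
    have : Continuous fun ρ : ℝ => r * ρ := by fun_prop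
    simpa using this.tendsto 0
  have h := (affineNorm_sub_isBigO (l := l) hq).comp_tendsto hlin
  have hr4 : ((fun ρ : ℝ => ρ ^ 4) ∘ fun ρ => r * ρ) =O[nhds 0] fun ρ : ℝ => ρ ^ 4 :=
    Asymptotics.IsBigO.of_bound (|r| ^ 4) (Filter.Eventually.of_forall fun z => by
      simp [mul_pow])
  have h' := h.trans hr4
  refine ((affineNorm_sub_isBigO (l := l) hp).sub h').congr_left fun ρ => ?_
  simp only [Function.comp]
  ring

/-- At the value of `r` for which the quadratic terms agree, the cubic terms break the inequality
for small `ρ > 0`. The third moment of `X` is positive because `l < 1 / 2`. -/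
lemma exists_affineNorm_lt_of_critical {l p q r : ℝ} (hl0 : 0 < l) (hl1 : l < 1 / 2) (hp : 1 < p)
    (hpq : p < q) (hr0 : 0 < r) (hr : (q - 1) * r ^ 2 = p - 1) :
    ∃ ρ ∈ Set.Icc 0 (1 / l), affineNorm l p ρ < affineNorm l q (r * ρ) := by
  have hc : (p - 1) * (p - 2) - (q - 1) * (q - 2) * r ^ 3 < 0 := by
    have hr1 : r < 1 := by
      by_contra! h
      nlinarith [one_le_pow₀ h (n := 2)]
    -- with `p - 1 = (q - 1) r²` the difference is `(q - 1) r² (r - 1) (1 + (q - 1) r)`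
    have : (p - 1) * (p - 2) - (q - 1) * (q - 2) * r ^ 3 =
        -((q - 1) * r ^ 2 * ((1 - r) * (1 + (q - 1) * r))) := by
      have : p = (q - 1) * r ^ 2 + 1 := by linarith
      rw [this]; ring
    rw [this, neg_lt_zero]
    have : 0 < q - 1 := by linarith
    have : 0 < 1 - r := by linarith
    positivity
  obtain ⟨C, hC0, hC⟩ := (affineNorm_diff_isBigO (l := l) (r := r) (by linarith : 0 < p)
    (by linarith : 0 < q)).exists_pos
  rw [Asymptotics.IsBigOWith] at hC
  set c := ((p - 1) * (p - 2) - (q - 1) * (q - 2) * r ^ 3) * (l * (1 - l) * (1 - 2 * l) / 6)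
    with hcdef
  have hc' : c < 0 := mul_neg_of_neg_of_pos hc (by
    have : 0 < 1 - l := by linarith
    have : 0 < 1 - 2 * l := by linarith
    positivity)
  have hd : 0 < min (1 / l) (-c / C) := lt_min (by positivity) (div_pos (by linarith) hC0)
  obtain ⟨ρ, hρ, hρ0, hρ1⟩ :=
    ((hC.filter_mono nhdsWithin_le_nhds).and (Ioo_mem_nhdsGT hd)).exists
  refine ⟨ρ, ⟨hρ0.le, (hρ1.trans_le (min_le_left _ _)).le⟩, ?_⟩
  have hρ2 := hρ1.trans_le (min_le_right _ _)
  rw [lt_div_iff₀ hC0] at hρ2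
  rw [hr, sub_self, zero_mul, zero_mul, zero_add, Real.norm_eq_abs, norm_pow, Real.norm_eq_abs,
    abs_of_pos hρ0] at hρ
  have h3 : 0 < ρ ^ 3 := by positivity
  have := (abs_le.1 hρ).2
  nlinarith [mul_lt_mul_of_pos_right hρ2 h3]

/-- Below the critical value of `r` the quadratic terms give the inequality near `ρ = 0`. -/
lemma eventually_affineNorm_le {l p q r : ℝ} (hl0 : 0 < l) (hl1 : l < 1) (hp : 0 < p) (hq : 0 < q)
    (hr : (q - 1) * r ^ 2 < p - 1) :
    ∀ᶠ ρ in nhds 0, affineNorm l q (r * ρ) ≤ affineNorm l p ρ := by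
  have h4 := affineNorm_diff_isBigO (l := l) (r := r) hp hq
  set a := ((p - 1) - (q - 1) * r ^ 2) * (l * (1 - l) / 2) with hadef
  set b := ((p - 1) * (p - 2) - (q - 1) * (q - 2) * r ^ 3) * (l * (1 - l) * (1 - 2 * l) / 6)
  have ha : 0 < a := mul_pos (by linarith) (by
    have : 0 < 1 - l := by linarith
    positivity)
  have h3 : (fun ρ : ℝ => (affineNorm l p ρ - affineNorm l q (r * ρ)) - a * ρ ^ 2)
      =O[nhds 0] fun ρ : ℝ => ρ ^ 3 :=
    ((h4.trans (isBigO_pow_of_le (by norm_num : 3 ≤ 4))).add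
      ((Asymptotics.isBigO_refl (fun ρ : ℝ => ρ ^ 3) (nhds 0)).const_mul_left b)).congr_left
        fun ρ => by ring
  obtain ⟨C, hC0, hC⟩ := h3.exists_pos
  rw [Asymptotics.IsBigOWith] at hC
  filter_upwards [hC, Metric.ball_mem_nhds (0 : ℝ) (div_pos ha hC0)] with ρ hρ hb
  rw [Metric.mem_ball, dist_zero_right, lt_div_iff₀ hC0, Real.norm_eq_abs] at hb
  rw [Real.norm_eq_abs, norm_pow, Real.norm_eq_abs] at hρ
  have h1 := (abs_le.1 hρ).1
  have h2 : |ρ| ^ 3 = |ρ| * ρ ^ 2 := by rw [← sq_abs ρ]; ring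
  rw [h2] at h1
  nlinarith [mul_le_mul_of_nonneg_right hb.le (sq_nonneg ρ)]

/-! ### The greatest admissible constant and its touching point -/

lemma continuous_affineNorm {l s : ℝ} (hs : 0 < s) : Continuous (affineNorm l s) := by
  have h1 := Real.continuous_rpow_const hs.le
  have h2 := Real.continuous_rpow_const (one_div_pos.2 hs).le
  unfold affineNorm twoPointNorm
  refine h2.comp ((continuous_const.mul (h1.comp ?_)).add (continuous_const.mul (h1.comp ?_))) <;>
  fun_prop

/-- The moment `𝔼 (1 + ρ X)^s`, without absolute values; meant for `0 ≤ ρ ≤ 1 / l`, where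
`1 + ρ X ≥ 0`. -/
noncomputable def affineMoment (l s ρ : ℝ) : ℝ :=
  l * (1 + ρ * (1 - l)) ^ s + (1 - l) * (1 - ρ * l) ^ s

lemma hasDerivAt_affineMoment {l s : ℝ} (hs : 1 ≤ s) (ρ : ℝ) :
    HasDerivAt (affineMoment l s)
      (s * (l * (1 - l)) * ((1 + ρ * (1 - l)) ^ (s - 1) - (1 - ρ * l) ^ (s - 1))) ρ := by
  have d1 : HasDerivAt (fun ρ : ℝ => 1 + ρ * (1 - l)) (1 - l) ρ := by
    simpa using ((hasDerivAt_id ρ).mul_const (1 - l)).const_add 1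
  have d2 : HasDerivAt (fun ρ : ℝ => 1 - ρ * l) (-l) ρ := by
    simpa using ((hasDerivAt_id ρ).mul_const l).const_sub 1
  refine (((d1.rpow_const (Or.inr hs)).const_mul l).add
    ((d2.rpow_const (Or.inr hs)).const_mul (1 - l))).congr_deriv ?_
  ring

lemma affineNorm_eq {l s ρ : ℝ} (hl0 : 0 < l) (hl1 : l < 1) (hρ : ρ ∈ Set.Icc 0 (1 / l)) :
    affineNorm l s ρ = affineMoment l s ρ ^ (1 / s) := by
  have h1l : 0 < 1 - l := by linarith
  have h0 := hρ.1
  have h1 := hρ.2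
  rw [le_div_iff₀ hl0] at h1
  rw [affineNorm, twoPointNorm, affineMoment, abs_of_nonneg (by positivity),
    abs_of_nonneg (by linarith)]

lemma affineMoment_pos {l s ρ : ℝ} (hl0 : 0 < l) (hl1 : l < 1) (hρ : ρ ∈ Set.Icc 0 (1 / l)) :
    0 < affineMoment l s ρ := by
  have h1l : 0 < 1 - l := by linarith
  have h0 := hρ.1
  have h1 := hρ.2
  rw [le_div_iff₀ hl0] at h1
  have := Real.rpow_nonneg (by linarith : 0 ≤ 1 - ρ * l) s
  unfold affineMoment
  positivity

lemma strictMonoOn_affineNorm {l s : ℝ} (hl0 : 0 < l) (hl1 : l < 1) (hs : 1 < s) :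
    StrictMonoOn (affineNorm l s) (Set.Icc 0 (1 / l)) := by
  have h1l : 0 < 1 - l := by linarith
  have hm : StrictMonoOn (affineMoment l s) (Set.Icc 0 (1 / l)) := by
    refine strictMonoOn_of_deriv_pos (convex_Icc _ _)
      (fun ρ _ => (hasDerivAt_affineMoment hs.le ρ).continuousAt.continuousWithinAt) ?_
    intro ρ hρ
    rw [interior_Icc] at hρ
    have h0 := hρ.1
    have h1 := hρ.2
    rw [lt_div_iff₀ hl0] at h1
    rw [(hasDerivAt_affineMoment hs.le ρ).deriv]
    refine mul_pos (by positivity) (sub_pos.2 ?_)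
    exact Real.rpow_lt_rpow (by linarith) (by nlinarith) (by linarith)
  intro a ha b hb hab
  rw [affineNorm_eq hl0 hl1 ha, affineNorm_eq hl0 hl1 hb]
  exact Real.rpow_lt_rpow (affineMoment_pos hl0 hl1 ha).le (hm ha hb hab) (by positivity)

/-- The `r ∈ [0, 1)` with `‖1 + r ρ X‖_q ≤ ‖1 + ρ X‖_p` for all `ρ ∈ [0, 1 / l]`. -/
def feasibleSet (l p q : ℝ) : Set ℝ :=
  {r | 0 ≤ r ∧ r < 1 ∧ ∀ ρ ∈ Set.Icc 0 (1 / l), affineNorm l q (r * ρ) ≤ affineNorm l p ρ}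

lemma mul_mem_Icc {l r ρ : ℝ} (hr0 : 0 ≤ r) (hr1 : r ≤ 1) (hρ : ρ ∈ Set.Icc 0 (1 / l)) :
    r * ρ ∈ Set.Icc 0 (1 / l) :=
  ⟨mul_nonneg hr0 hρ.1, (mul_le_of_le_one_left hρ.1 hr1).trans hρ.2⟩

/-- The greatest admissible `r` exists, and equality holds there for some `ρ ∈ (0, 1 / l]`. It
lies strictly below the critical value of the expansion at `ρ = 0`, so equality cannot escape to
`ρ = 0`; if the inequality were strict on the rest of the compact interval, a slightly larger `r`
would do. -/
lemma exists_isGreatest_feasibleSet {l p q : ℝ} (hl0 : 0 < l) (hl1 : l < 1 / 2) (hp : 1 < p)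
    (hpq : p < q) : ∃ σ, IsGreatest (feasibleSet l p q) σ ∧
      ∃ ρ ∈ Set.Ioc 0 (1 / l), affineNorm l q (σ * ρ) = affineNorm l p ρ := by
  have hl1' : l < 1 := by linarith
  have hp0 : 0 < p := by linarith
  have hq0 : 0 < q := by linarith
  have hq1 : 0 < q - 1 := by linarith
  have hp1 : 0 < p - 1 := by linarith
  set r₀ := √((p - 1) / (q - 1)) with hr₀
  have hr₀0 : 0 < r₀ := Real.sqrt_pos.2 (div_pos hp1 hq1)
  have hr₀sq : (q - 1) * r₀ ^ 2 = p - 1 := by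
    rw [hr₀, Real.sq_sqrt (div_pos hp1 hq1).le, mul_div_cancel₀ _ hq1.ne']
  have hr₀1 : r₀ < 1 := by
    by_contra! h
    nlinarith [one_le_pow₀ h (n := 2)]
  obtain ⟨ρ₀, hρ₀, hviol⟩ := exists_affineNorm_lt_of_critical hl0 hl1 hp hpq hr₀0 hr₀sq
  have hmono := strictMonoOn_affineNorm hl0 hl1' (hp.trans hpq)
  have hcq := continuous_affineNorm (l := l) hq0
  have hcp := continuous_affineNorm (l := l) hp0
  have hub : ∀ r ∈ feasibleSet l p q, r < r₀ := by
    intro r hr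
    by_contra! h
    have h1 : affineNorm l q (r₀ * ρ₀) ≤ affineNorm l q (r * ρ₀) :=
      hmono.monotoneOn (mul_mem_Icc hr₀0.le hr₀1.le hρ₀) (mul_mem_Icc hr.1 hr.2.1.le hρ₀)
        (mul_le_mul_of_nonneg_right h hρ₀.1)
    exact absurd (hr.2.2 ρ₀ hρ₀) (not_le.2 (hviol.trans_le h1))
  have hclosed : IsClosed (feasibleSet l p q) := by
    have : feasibleSet l p q = Set.Icc 0 r₀ ∩
        ⋂ ρ ∈ Set.Icc 0 (1 / l), {r | affineNorm l q (r * ρ) ≤ affineNorm l p ρ} := by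
      ext r
      simp only [Set.mem_inter_iff, Set.mem_iInter, Set.mem_ofPred_eq]
      exact ⟨fun h => ⟨⟨h.1, (hub r h).le⟩, h.2.2⟩,
        fun h => ⟨h.1.1, h.1.2.trans_lt hr₀1, h.2⟩⟩
    rw [this]
    refine isClosed_Icc.inter (isClosed_biInter fun ρ _ => ?_)
    exact isClosed_le (hcq.comp (by fun_prop)) continuous_const
  have hne : (feasibleSet l p q).Nonempty :=
    ⟨0, le_rfl, one_pos, fun ρ _ => by
      rw [zero_mul, affineNorm_zero]; exact one_le_affineNorm hl0 hl1' hp.le⟩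
  have hbdd : BddAbove (feasibleSet l p q) := ⟨r₀, fun r hr => (hub r hr).le⟩
  set σ := sSup (feasibleSet l p q) with hσ
  have hmem : σ ∈ feasibleSet l p q := hclosed.csSup_mem hne hbdd
  refine ⟨σ, ⟨hmem, fun r hr => le_csSup hbdd hr⟩, ?_⟩
  by_contra! hcon
  have hlt : ∀ ρ ∈ Set.Ioc 0 (1 / l), affineNorm l q (σ * ρ) < affineNorm l p ρ := fun ρ hρ =>
    lt_of_le_of_ne (hmem.2.2 ρ ⟨hρ.1.le, hρ.2⟩) (hcon ρ hρ)
  have hσr₀ := hub σ hmem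
  set r₁ := (σ + r₀) / 2 with hr₁
  have hσr₁ : σ < r₁ := by linarith
  have hr₁r₀ : r₁ < r₀ := by linarith
  have hr₁0 : 0 ≤ r₁ := hmem.1.trans hσr₁.le
  have hloc := eventually_affineNorm_le (l := l) (p := p) (q := q) (r := r₁) hl0 hl1' hp0 hq0
    (by nlinarith [mul_pos hq1 (mul_pos (sub_pos.2 hr₁r₀) (add_pos_of_nonneg_of_pos hr₁0 hr₀0))])
  obtain ⟨δ, hδ, hball⟩ := Metric.eventually_nhds_iff.1 hloc
  have hK : ∀ᶠ r in nhds σ, ∀ ρ ∈ Set.Icc (δ / 2) (1 / l),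
      affineNorm l q (r * ρ) < affineNorm l p ρ := by
    refine isCompact_Icc.eventually_forall_of_forall_eventually fun ρ hρ => ?_
    have c1 : Continuous fun z : ℝ × ℝ => affineNorm l q (z.1 * z.2) := hcq.comp (by fun_prop)
    have c2 : Continuous fun z : ℝ × ℝ => affineNorm l p z.2 := hcp.comp (by fun_prop)
    exact c1.continuousAt.eventually_lt c2.continuousAt (hlt ρ ⟨by linarith [hρ.1], hρ.2⟩)
  obtain ⟨r, hr, hrσ, hrr₁⟩ :=
    ((hK.filter_mono nhdsWithin_le_nhds).and (Ioo_mem_nhdsGT hσr₁)).exists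
  have hr0 : 0 ≤ r := hmem.1.trans hrσ.le
  have hrmem : r ∈ feasibleSet l p q := by
    refine ⟨hr0, by linarith, fun ρ hρ => ?_⟩
    rcases le_or_gt (δ / 2) ρ with h | h
    · exact (hr ρ ⟨h, hρ.2⟩).le
    · refine le_trans ?_ (hball (y := ρ) ?_)
      · exact hmono.monotoneOn (mul_mem_Icc hr0 (by linarith) hρ)
          (mul_mem_Icc hr₁0 (by linarith) hρ) (mul_le_mul_of_nonneg_right hrr₁.le hρ.1)
      · rw [Real.dist_eq, sub_zero, abs_of_nonneg hρ.1]; linarith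
  exact absurd (le_csSup hbdd hrmem) (not_le.2 hrσ)

/-! ### The touching point solves the system -/

/-- The `ρ` for which `1 + ρ X` is proportional to the function with values `1` (mass `l`) and `x`
(mass `1 - l`). It maps `[0, 1)` onto `(0, 1 / l]`, with `x = 0` corresponding to `1 / l`. -/
noncomputable def slopeOf (l x : ℝ) : ℝ := (1 - x) / (l + (1 - l) * x)

lemma one_add_slopeOf {l x : ℝ} (hl0 : 0 < l) (hl1 : l < 1) (hx : 0 ≤ x) :
    1 + slopeOf l x * (1 - l) = (l + (1 - l) * x)⁻¹ * 1 := by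
  have h1l : 0 < 1 - l := by linarith
  have : l + (1 - l) * x ≠ 0 := by positivity
  unfold slopeOf; field_simp; ring

lemma one_sub_slopeOf {l x : ℝ} (hl0 : 0 < l) (hl1 : l < 1) (hx : 0 ≤ x) :
    1 - slopeOf l x * l = (l + (1 - l) * x)⁻¹ * x := by
  have h1l : 0 < 1 - l := by linarith
  have : l + (1 - l) * x ≠ 0 := by positivity
  unfold slopeOf; field_simp; ring

lemma slopeOf_mem {l x : ℝ} (hl0 : 0 < l) (hl1 : l < 1) (hx : 0 ≤ x) (hx1 : x < 1) :
    slopeOf l x ∈ Set.Ioc 0 (1 / l) := by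
  have h1l : 0 < 1 - l := by linarith
  have : 0 < l + (1 - l) * x := by positivity
  refine ⟨div_pos (by linarith) this, ?_⟩
  rw [slopeOf, div_le_div_iff₀ this hl0]
  nlinarith

lemma exists_slopeOf_eq {l ρ : ℝ} (hl0 : 0 < l) (hl1 : l < 1) (hρ : ρ ∈ Set.Ioc 0 (1 / l)) :
    ∃ x, 0 ≤ x ∧ x < 1 ∧ slopeOf l x = ρ ∧ (ρ < 1 / l → 0 < x) := by
  have h1l : 0 < 1 - l := by linarith
  have h0 := hρ.1
  have h1 := hρ.2
  rw [le_div_iff₀ hl0] at h1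
  have hc : 0 < 1 + ρ * (1 - l) := by positivity
  refine ⟨(1 - ρ * l) / (1 + ρ * (1 - l)), div_nonneg (by linarith) hc.le, ?_, ?_, fun h => ?_⟩
  · rw [div_lt_one hc]; nlinarith
  · unfold slopeOf; field_simp; ring
  · rw [lt_div_iff₀ hl0] at h
    exact div_pos (by linarith) hc

lemma affineNorm_slopeOf {l s x : ℝ} (hl0 : 0 < l) (hl1 : l < 1) (hs : 0 < s) (hx : 0 ≤ x) :
    affineNorm l s (slopeOf l x) = (l + (1 - l) * x ^ s) ^ (1 / s) / (l + (1 - l) * x) := by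
  have h1l : 0 < 1 - l := by linarith
  have : 0 < l + (1 - l) * x := by positivity
  rw [affineNorm, one_add_slopeOf hl0 hl1 hx, one_sub_slopeOf hl0 hl1 hx,
    abs_of_nonneg (by positivity), abs_of_nonneg (by positivity),
    twoPointNorm_mul hl0 hl1 hs.ne' (by positivity) zero_le_one hx, twoPointNorm, Real.one_rpow,
    mul_one]
  exact (div_eq_inv_mul _ _).symm

lemma crossValue_mul_slopeOf {l x y : ℝ} (hl0 : 0 < l) (hl1 : l < 1) (hx : 0 ≤ x) (hx1 : x < 1)
    (hy : 0 ≤ y) : crossValue l x y * slopeOf l x = slopeOf l y := by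
  have h1l : 0 < 1 - l := by linarith
  have h1 : l + (1 - l) * x ≠ 0 := by positivity
  have h2 : l + (1 - l) * y ≠ 0 := by positivity
  have h3 : 1 - x ≠ 0 := by linarith
  have h4 : x * (1 - l) + l ≠ 0 := by positivity
  have h5 : y * (1 - l) + l ≠ 0 := by positivity
  unfold crossValue slopeOf
  field_simp
  ring

/-- In the coordinate `x`, the logarithmic derivative of `‖1 + ρ X‖_s` with respect to `log ρ` is,
up to the factor `l (1 - l)`, a side of the second equation of the system. -/
lemma slopeOf_mul_logDeriv {l s x : ℝ} (hl0 : 0 < l) (hl1 : l < 1) (hx : 0 ≤ x) :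
    slopeOf l x * (((1 + slopeOf l x * (1 - l)) ^ (s - 1) - (1 - slopeOf l x * l) ^ (s - 1)) /
      affineMoment l s (slopeOf l x)) =
      (1 - x) * (1 - x ^ (s - 1)) / (l + (1 - l) * x ^ s) := by
  have h1l : 0 < 1 - l := by linarith
  have hm : 0 < l + (1 - l) * x := by positivity
  rw [affineMoment, one_add_slopeOf hl0 hl1 hx, one_sub_slopeOf hl0 hl1 hx]
  have hc : 0 < (l + (1 - l) * x)⁻¹ := by positivity
  have e : slopeOf l x = (l + (1 - l) * x)⁻¹ * (1 - x) := by rw [slopeOf, div_eq_inv_mul]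
  rw [e]
  set c := (l + (1 - l) * x)⁻¹
  have hcs : c ^ s = c * c ^ (s - 1) := by
    rw [mul_comm, ← Real.rpow_add_one hc.ne']; simp
  rw [Real.mul_rpow hc.le hx, Real.mul_rpow hc.le hx, mul_one, hcs]
  have : 0 < c ^ (s - 1) := by positivity
  have : 0 < l + (1 - l) * x ^ s := by positivity
  have e2 : l * (c * c ^ (s - 1)) + (1 - l) * (c * c ^ (s - 1) * x ^ s) =
      c * c ^ (s - 1) * (l + (1 - l) * x ^ s) := by ring
  rw [e2]
  field_simp

lemma HasDerivAt.nonpos_of_left_min {f : ℝ → ℝ} {f' a b : ℝ} (hf : HasDerivAt f f' b) (hab : a < b)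
    (h : ∀ x ∈ Set.Ioo a b, f b ≤ f x) : f' ≤ 0 := by
  have ht := (hasDerivAt_iff_tendsto_slope.1 hf).mono_left
    (nhdsWithin_mono b (fun x (hx : x < b) => hx.ne) : nhdsWithin b (Set.Iio b) ≤ _)
  refine le_of_tendsto ht ?_
  filter_upwards [Ioo_mem_nhdsLT hab] with x hx
  rw [slope_def_field]
  exact div_nonpos_of_nonneg_of_nonpos (by linarith [h x hx]) (by linarith [hx.2])

/-- A touching point solves the system: the first equation is equality of the norms, the second is
the vanishing of the derivative of the logarithm of their quotient. -/
lemma exists_isSystemSolution_of_tight {l p q σ ρ : ℝ} (hl0 : 0 < l) (hl1 : l < 1) (hp : 1 < p)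
    (hpq : p < q) (hσ : σ ∈ feasibleSet l p q) (hρ : ρ ∈ Set.Ioc 0 (1 / l))
    (htight : affineNorm l q (σ * ρ) = affineNorm l p ρ) :
    ∃ x y, IsSystemSolution l p q x y ∧ σ = crossValue l x y := by
  have h1l : 0 < 1 - l := by linarith
  have hq : 1 < q := hp.trans hpq
  have hp0 : 0 < p := by linarith
  have hq0 : 0 < q := by linarith
  have hρI : ρ ∈ Set.Icc 0 (1 / l) := ⟨hρ.1.le, hρ.2⟩
  have hσ0 : 0 < σ := by
    refine hσ.1.lt_of_ne fun h => ?_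
    have := strictMonoOn_affineNorm hl0 hl1 hp ⟨le_rfl, by positivity⟩ hρI hρ.1
    rw [← h, zero_mul, affineNorm_zero] at htight
    rw [affineNorm_zero] at this
    linarith
  have hσρ : σ * ρ < 1 / l := lt_of_lt_of_le (mul_lt_of_lt_one_left hρ.1 hσ.2.1) hρ.2
  have hσρ0 : 0 < σ * ρ := mul_pos hσ0 hρ.1
  have hσρI : σ * ρ ∈ Set.Icc 0 (1 / l) := ⟨hσρ0.le, hσρ.le⟩
  obtain ⟨x, hx0, hx1, hxρ, hxpos⟩ := exists_slopeOf_eq hl0 hl1 hρ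
  obtain ⟨y, -, hy1, hyρ, hypos⟩ := exists_slopeOf_eq hl0 hl1 ⟨hσρ0, hσρ.le⟩
  have hy0 := hypos hσρ
  -- the logarithm of the quotient of the two sides is nonnegative and vanishes at `ρ`
  set F : ℝ → ℝ := fun t => 1 / p * Real.log (affineMoment l p t) -
    1 / q * Real.log (affineMoment l q (σ * t)) with hF
  set D : ℝ → ℝ → ℝ := fun s t =>
    ((1 + t * (1 - l)) ^ (s - 1) - (1 - t * l) ^ (s - 1)) / affineMoment l s t with hD
  have hlog : ∀ {s t : ℝ}, t ∈ Set.Icc 0 (1 / l) →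
      1 / s * Real.log (affineMoment l s t) = Real.log (affineNorm l s t) := by
    intro s t ht
    rw [affineNorm_eq hl0 hl1 ht, Real.log_rpow (affineMoment_pos hl0 hl1 ht)]
  have hpos : ∀ {s t : ℝ}, t ∈ Set.Icc 0 (1 / l) → 0 < affineNorm l s t := by
    intro s t ht
    rw [affineNorm_eq hl0 hl1 ht]
    exact Real.rpow_pos_of_pos (affineMoment_pos hl0 hl1 ht) _
  have hFρ : F ρ = 0 := by
    simp only [hF]
    rw [hlog hρI, hlog hσρI, htight, sub_self]
  have hFnn : ∀ t ∈ Set.Icc 0 (1 / l), 0 ≤ F t := by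
    intro t ht
    have ht' := mul_mem_Icc hσ.1 hσ.2.1.le ht
    simp only [hF]
    rw [hlog ht, hlog ht', sub_nonneg]
    exact Real.log_le_log (hpos ht') (hσ.2.2 t ht)
  have hder : HasDerivAt F (l * (1 - l) * (D p ρ - σ * D q (σ * ρ))) ρ := by
    have hin : HasDerivAt (fun t : ℝ => σ * t) σ ρ := by
      simpa using (hasDerivAt_id ρ).const_mul σ
    have d1 := ((hasDerivAt_affineMoment (l := l) hp.le ρ).log
      (affineMoment_pos hl0 hl1 hρI).ne').const_mul (1 / p)
    have d2 := (((hasDerivAt_affineMoment (l := l) hq.le (σ * ρ)).comp ρ hin).log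
      (affineMoment_pos hl0 hl1 hσρI).ne').const_mul (1 / q)
    refine (d1.sub d2).congr_deriv ?_
    simp only [hD, Function.comp]
    field_simp
  have hle : D p ρ ≤ σ * D q (σ * ρ) := by
    have := hder.nonpos_of_left_min hρ.1 fun t ht => by
      rw [hFρ]; exact hFnn t ⟨ht.1.le, ht.2.le.trans hρ.2⟩
    have h2 := nonpos_of_mul_nonpos_right this (by positivity)
    linarith
  have hDp : ρ * D p ρ = (1 - x) * (1 - x ^ (p - 1)) / (l + (1 - l) * x ^ p) := by
    rw [← slopeOf_mul_logDeriv hl0 hl1 hx0, hxρ]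
  have hDq : σ * ρ * D q (σ * ρ) = (1 - y) * (1 - y ^ (q - 1)) / (l + (1 - l) * y ^ q) := by
    rw [← slopeOf_mul_logDeriv hl0 hl1 hy0.le, hyρ]
  -- `x = 0` is the endpoint `ρ = 1 / l`, where only the one-sided condition `hle` is available;
  -- it fails there
  have hx : 0 < x := by
    refine hx0.lt_of_ne fun h => ?_
    have h3 : (1 - x) * (1 - x ^ (p - 1)) / (l + (1 - l) * x ^ p) ≤
        (1 - y) * (1 - y ^ (q - 1)) / (l + (1 - l) * y ^ q) := by
      rw [← hDp, ← hDq, mul_assoc, mul_left_comm]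
      exact mul_le_mul_of_nonneg_left hle hρ.1.le
    rw [← h, Real.zero_rpow (by linarith), Real.zero_rpow hp0.ne'] at h3
    have a1 : 0 < y ^ (q - 1) := by positivity
    have a2 : 0 < y ^ q := by positivity
    have a3 : y ^ (q - 1) < 1 := Real.rpow_lt_one hy0.le hy1 (by linarith)
    simp only [sub_zero, mul_one, mul_zero, add_zero] at h3
    rw [div_le_div_iff₀ hl0 (by positivity)] at h3
    nlinarith [mul_pos hy0 (sub_pos.2 a3), mul_pos hl0 a1, mul_pos h1l a2,
      mul_pos hl0 (mul_pos hy0 (sub_pos.2 a3))]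
  have hρ1 : ρ < 1 / l := by
    refine hρ.2.lt_of_ne fun h => ?_
    have := one_sub_slopeOf hl0 hl1 hx0
    rw [hxρ, h, one_div_mul_cancel hl0.ne', sub_self] at this
    have : 0 < (l + (1 - l) * x)⁻¹ * x := by positivity
    linarith
  have heq : D p ρ = σ * D q (σ * ρ) := by
    have hmin : IsLocalMin F ρ := by
      filter_upwards [Ioo_mem_nhds hρ.1 hρ1] with t ht
      rw [hFρ]; exact hFnn t ⟨ht.1.le, ht.2.le⟩
    have := hmin.hasDerivAt_eq_zero hder
    have hl : l * (1 - l) ≠ 0 := by positivity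
    have := (mul_eq_zero.1 this).resolve_left hl
    linarith
  refine ⟨x, y, ⟨⟨hx, hx1⟩, ⟨hy0, hy1⟩, ?_, ?_⟩, ?_⟩
  · rw [← affineNorm_slopeOf hl0 hl1 hp0 hx0, ← affineNorm_slopeOf hl0 hl1 hq0 hy0.le, hxρ, hyρ,
      htight]
  · rw [← hDp, ← hDq, heq]; ring
  · have := crossValue_mul_slopeOf (y := y) hl0 hl1 hx0 hx1 hy0.le
    rw [hxρ, hyρ] at this
    exact (mul_right_cancel₀ hρ.1.ne' this).symm

/-- A solution `(x, y)` of the first equation exhibits equality of norms at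
`r = crossValue l x y`, and `ρ ↦ ‖1 + ρ X‖_q` is strictly increasing. -/
lemma le_crossValue {l p q σ x y : ℝ} (hl0 : 0 < l) (hl1 : l < 1) (hp : 1 < p) (hpq : p < q)
    (hσ : σ ∈ feasibleSet l p q) (h : IsSystemSolution l p q x y) : σ ≤ crossValue l x y := by
  have hq : 1 < q := hp.trans hpq
  have hx := h.x_mem
  have hy := h.y_mem
  have hxI := slopeOf_mem hl0 hl1 hx.1.le hx.2
  have hyI := slopeOf_mem hl0 hl1 hy.1.le hy.2
  have h1 := hσ.2.2 _ ⟨hxI.1.le, hxI.2⟩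
  rw [affineNorm_slopeOf hl0 hl1 (by linarith) hx.1.le, h.eq_norm,
    ← affineNorm_slopeOf hl0 hl1 (by linarith) hy.1.le] at h1
  have h2 := ((strictMonoOn_affineNorm hl0 hl1 hq).le_iff_le
    (mul_mem_Icc hσ.1 hσ.2.1.le ⟨hxI.1.le, hxI.2⟩) ⟨hyI.1.le, hyI.2⟩).1 h1
  rw [← crossValue_mul_slopeOf hl0 hl1 hx.1.le hx.2 hy.1.le] at h2
  exact le_of_mul_le_mul_right h2 hxI.1

/-! ### A tangent-line inequality for powers of the hyperbolic cosine -/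

/-- `sinh` is superlinear on `[0, ∞)`. -/
lemma sinh_mul_le {t y : ℝ} (ht0 : 0 ≤ t) (ht1 : t ≤ 1) (hy : 0 ≤ y) :
    Real.sinh (t * y) ≤ t * Real.sinh y := by
  have hm : MonotoneOn (fun y => t * Real.sinh y - Real.sinh (t * y)) (Set.Ici 0) := by
    have hd : ∀ y : ℝ, HasDerivAt (fun y => t * Real.sinh y - Real.sinh (t * y))
        (t * Real.cosh y - Real.cosh (t * y) * t) y := fun y =>
      ((Real.hasDerivAt_sinh y).const_mul t).sub
        ((by simpa using (hasDerivAt_id y).const_mul t : HasDerivAt (fun y => t * y) t y).sinh)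
    refine monotoneOn_of_deriv_nonneg (convex_Ici _)
      (fun y _ => (hd y).continuousAt.continuousWithinAt)
      (fun y _ => (hd y).differentiableAt.differentiableWithinAt) fun y hy => ?_
    rw [interior_Ici, Set.mem_Ioi] at hy
    rw [(hd y).deriv]
    have : Real.cosh (t * y) ≤ Real.cosh y := by
      rw [Real.cosh_le_cosh, abs_of_nonneg (by positivity), abs_of_pos hy]
      exact mul_le_of_le_one_left hy.le ht1
    nlinarith
  have := hm (Set.self_mem_Ici) hy hy
  simp only [mul_zero, Real.sinh_zero, sub_zero] at this
  linarith

/-- The derivative of `cosh(s)^m` with respect to `cosh(m s)` is increasing in `s > 0`, that is,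
`cosh(s)^m` is a convex function of `cosh(m s)`. -/
lemma monotoneOn_cosh_rpow_mul_sinh_div {m : ℝ} (hm1 : 1 < m) (hm2 : m < 2) :
    MonotoneOn (fun s => Real.cosh s ^ (m - 1) * Real.sinh s / Real.sinh (m * s))
      (Set.Ioi 0) := by
  have hS : ∀ s : ℝ, 0 < s → 0 < Real.sinh (m * s) := fun s hs =>
    Real.sinh_pos_iff.2 (by positivity)
  have hd : ∀ s : ℝ, 0 < s → HasDerivAt
      (fun s => Real.cosh s ^ (m - 1) * Real.sinh s / Real.sinh (m * s))
      (((Real.sinh s * (m - 1) * Real.cosh s ^ (m - 1 - 1) * Real.sinh s +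
        Real.cosh s ^ (m - 1) * Real.cosh s) * Real.sinh (m * s) -
        Real.cosh s ^ (m - 1) * Real.sinh s * (Real.cosh (m * s) * m)) /
          Real.sinh (m * s) ^ 2) s := fun s hs =>
    (((Real.hasDerivAt_cosh s).rpow_const (Or.inl (Real.cosh_pos s).ne')).mul
      (Real.hasDerivAt_sinh s)).div
      ((by simpa using (hasDerivAt_id s).const_mul m : HasDerivAt (fun y => m * y) m s).sinh)
      (hS s hs).ne'
  refine monotoneOn_of_deriv_nonneg (convex_Ioi _)
    (fun y hy => (hd y hy).continuousAt.continuousWithinAt)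
    (fun y hy => (hd y (by simpa using hy)).differentiableAt.differentiableWithinAt) fun s hs => ?_
  rw [interior_Ioi, Set.mem_Ioi] at hs
  rw [(hd s hs).deriv]
  refine div_nonneg ?_ (sq_nonneg _)
  have hc := Real.cosh_pos s
  have e1 : Real.cosh s ^ (m - 1) = Real.cosh s ^ (m - 1 - 1) * Real.cosh s := by
    rw [← Real.rpow_add_one hc.ne']; simp
  -- the numerator reduces to superlinearity of `sinh` between `(2 - m) s` and `m s`
  have key : m * Real.sinh ((2 - m) * s) ≤ (2 - m) * Real.sinh (m * s) := by
    have := sinh_mul_le (t := (2 - m) / m) (y := m * s) (div_nonneg (by linarith) (by linarith))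
      (by rw [div_le_one (by linarith)]; linarith) (by positivity)
    rw [show (2 - m) / m * (m * s) = (2 - m) * s by field_simp] at this
    calc m * Real.sinh ((2 - m) * s) ≤ m * ((2 - m) / m * Real.sinh (m * s)) := by gcongr
      _ = _ := by field_simp
  have hsub : Real.sinh ((2 - m) * s) = 2 * Real.sinh s * Real.cosh s * Real.cosh (m * s) -
      (Real.cosh s ^ 2 + Real.sinh s ^ 2) * Real.sinh (m * s) := by
    rw [show (2 - m) * s = 2 * s - m * s by ring, Real.sinh_sub, Real.sinh_two_mul,
      Real.cosh_two_mul]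
  rw [hsub] at key
  have hid : (Real.sinh s * (m - 1) * Real.cosh s ^ (m - 1 - 1) * Real.sinh s +
        Real.cosh s ^ (m - 1) * Real.cosh s) * Real.sinh (m * s) -
        Real.cosh s ^ (m - 1) * Real.sinh s * (Real.cosh (m * s) * m) =
      Real.cosh s ^ (m - 1 - 1) * (((m - 1) * Real.sinh s ^ 2 + Real.cosh s ^ 2) *
        Real.sinh (m * s) - m * Real.sinh s * Real.cosh s * Real.cosh (m * s)) := by
    rw [e1]; ring
  rw [hid]
  refine mul_nonneg (by positivity) ?_
  have := Real.cosh_sq s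
  rw [Real.cosh_sq s] at key ⊢
  linarith

/-- `cosh(s)^m`, as a convex function of `cosh(m s)`, lies above its tangent at `s = c`. -/
lemma cosh_rpow_tangent_le {m c : ℝ} (hm1 : 1 < m) (hm2 : m < 2) (hc : 0 < c) (s : ℝ) :
    Real.cosh c ^ m * (1 + Real.sinh c / (Real.cosh c * Real.sinh (m * c)) *
      (Real.cosh (m * s) - Real.cosh (m * c))) ≤ Real.cosh s ^ m := by
  wlog hs : 0 ≤ s generalizing s
  · have := this (-s) (by linarith)
    rwa [mul_neg, Real.cosh_neg, Real.cosh_neg] at this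
  set k : ℝ → ℝ := fun s => Real.cosh s ^ (m - 1) * Real.sinh s / Real.sinh (m * s) with hk
  have hkm : MonotoneOn k (Set.Ioi 0) := monotoneOn_cosh_rpow_mul_sinh_div hm1 hm2
  have hS : ∀ s : ℝ, 0 < s → 0 < Real.sinh (m * s) := fun s hs =>
    Real.sinh_pos_iff.2 (by positivity)
  have hd : ∀ s : ℝ, HasDerivAt (fun s => Real.cosh s ^ m - k c * Real.cosh (m * s))
      (Real.sinh s * m * Real.cosh s ^ (m - 1) - k c * (Real.sinh (m * s) * m)) s := fun s =>
    ((Real.hasDerivAt_cosh s).rpow_const (Or.inl (Real.cosh_pos s).ne')).sub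
      (((by simpa using (hasDerivAt_id s).const_mul m : HasDerivAt (fun y => m * y) m s).cosh
        ).const_mul (k c))
  have hd' : ∀ s : ℝ, 0 < s → Real.sinh s * m * Real.cosh s ^ (m - 1) -
      k c * (Real.sinh (m * s) * m) = m * Real.sinh (m * s) * (k s - k c) := by
    intro s hs
    have : k s * Real.sinh (m * s) = Real.cosh s ^ (m - 1) * Real.sinh s :=
      div_mul_cancel₀ _ (hS s hs).ne'
    linear_combination -m * this
  have hmain : Real.cosh c ^ m - k c * Real.cosh (m * c) ≤
      Real.cosh s ^ m - k c * Real.cosh (m * s) := by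
    rcases le_total s c with hsc | hsc
    · refine (antitoneOn_of_deriv_nonpos (convex_Icc 0 c)
        (f := fun s => Real.cosh s ^ m - k c * Real.cosh (m * s))
        (fun y _ => (hd y).continuousAt.continuousWithinAt)
        (fun y _ => (hd y).differentiableAt.differentiableWithinAt) fun y hy => ?_)
        ⟨hs, hsc⟩ ⟨hc.le, le_rfl⟩ hsc
      rw [interior_Icc] at hy
      rw [(hd y).deriv, hd' y hy.1]
      exact mul_nonpos_of_nonneg_of_nonpos (mul_pos (by linarith) (hS y hy.1)).le
        (sub_nonpos.2 (hkm hy.1 hc hy.2.le))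
    · refine (monotoneOn_of_deriv_nonneg (convex_Ici c)
        (f := fun s => Real.cosh s ^ m - k c * Real.cosh (m * s))
        (fun y _ => (hd y).continuousAt.continuousWithinAt)
        (fun y _ => (hd y).differentiableAt.differentiableWithinAt) fun y hy => ?_)
        Set.self_mem_Ici hsc hsc
      rw [interior_Ici, Set.mem_Ioi] at hy
      have hy0 := hc.trans hy
      rw [(hd y).deriv, hd' y hy0]
      exact mul_nonneg (mul_pos (by linarith) (hS y hy0)).le (sub_nonneg.2 (hkm hc hy0 hy.le))
  have hkc : Real.cosh c ^ m * (Real.sinh c / (Real.cosh c * Real.sinh (m * c))) = k c := by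
    have hcp := Real.cosh_pos c
    have e1 : Real.cosh c ^ m = Real.cosh c ^ (m - 1) * Real.cosh c := by
      rw [← Real.rpow_add_one hcp.ne']; simp
    have := hS c hc
    simp only [hk]
    rw [e1]
    field_simp
  rw [mul_add, mul_one, ← mul_assoc, hkc]
  linarith

/-- For `r = sinh((2 - m) c) / sinh(m c)` the quadratic form `r 𝔼 f² + (1 - r) (𝔼 f)²`, evaluated
at `f = (u, 1/u)` with `u² = exp(m (c - s))` and `w = exp(m s)`, equals the tangent line of
`cosh_rpow_tangent_le` divided by `cosh(c)^m`. -/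
lemma noiseForm_coeff {m c l r : ℝ} (hm : 0 < m) (hc : 0 < c)
    (hl : l = Real.exp (-c) / (2 * Real.cosh c))
    (hr : r = Real.sinh ((2 - m) * c) / Real.sinh (m * c)) (w : ℝ) (hw : w ≠ 0) :
    (l * (r + (1 - r) * l)) * (Real.exp (m * c) * w⁻¹) +
      ((1 - l) * (r + (1 - r) * (1 - l))) * ((Real.exp (m * c))⁻¹ * w) +
      2 * (1 - r) * (l * (1 - l)) =
    1 + Real.sinh c / (Real.cosh c * Real.sinh (m * c)) * ((w + w⁻¹) / 2 - Real.cosh (m * c)) := by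
  have hE : 1 < Real.exp c := Real.one_lt_exp_iff.2 hc
  have hM : 1 < Real.exp (m * c) := Real.one_lt_exp_iff.2 (by positivity)
  have e1 : Real.exp (-c) = (Real.exp c)⁻¹ := Real.exp_neg c
  have e2 : Real.exp (-(m * c)) = (Real.exp (m * c))⁻¹ := Real.exp_neg _
  have e3 : Real.exp ((2 - m) * c) = Real.exp c ^ 2 * (Real.exp (m * c))⁻¹ := by
    rw [← e2, ← Real.exp_nat_mul, ← Real.exp_add]; congr 1; push_cast; ring
  have e4 : Real.exp (-((2 - m) * c)) = (Real.exp c ^ 2)⁻¹ * Real.exp (m * c) := by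
    rw [Real.exp_neg, e3, mul_inv, inv_inv]
  rw [hr, hl]
  simp only [Real.sinh_eq, Real.cosh_eq, e1, e2, e3, e4]
  set E := Real.exp c
  set M := Real.exp (m * c)
  have hE0 : 0 < E := by linarith
  have hM0 : 0 < M := by linarith
  have h1 : M ^ 2 - 1 ≠ 0 := by nlinarith
  have h2 : E ^ 2 + 1 ≠ 0 := by positivity
  have h3 : M - M⁻¹ = (M ^ 2 - 1) / M := by field_simp
  have h4 : E + E⁻¹ = (E ^ 2 + 1) / E := by field_simp
  rw [h3, h4]
  field_simp
  ring

/-! ### Conjugate exponents -/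

lemma one_sub_eq_of_eq_exp_div {c l : ℝ} (hl : l = Real.exp (-c) / (2 * Real.cosh c)) :
    1 - l = Real.exp c / (2 * Real.cosh c) := by
  have := Real.cosh_pos c
  rw [hl, Real.cosh_eq] at *
  field_simp
  ring

/-- `r 𝔼 f² + (1 - r) (𝔼 f)² = 𝔼 (f T_r f) ≤ ‖f‖_p²` for positive `f = (a, b)`. -/
lemma noiseForm_le_of_pos {m c l r p a b : ℝ} (hm1 : 1 < m) (hm2 : m < 2) (hc : 0 < c)
    (hp : p = 2 / m) (hl0 : 0 < l) (hl1 : l < 1)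
    (hl : l = Real.exp (-c) / (2 * Real.cosh c))
    (hr : r = Real.sinh ((2 - m) * c) / Real.sinh (m * c)) (ha : 0 < a) (hb : 0 < b) :
    r * (l * a ^ 2 + (1 - l) * b ^ 2) + (1 - r) * (l * a + (1 - l) * b) ^ 2 ≤
      twoPointNorm l p a b ^ 2 := by
  have hm0 : 0 < m := by linarith
  have hp0 : 0 < p := by rw [hp]; positivity
  have h1l := one_sub_eq_of_eq_exp_div hl
  have hC := Real.cosh_pos c
  -- write `(a, b) = P (u, 1/u)` with `u = exp v`
  obtain ⟨P, v, hP, ha', hb'⟩ : ∃ P v : ℝ, 0 < P ∧ a = P * Real.exp v ∧ b = P * Real.exp (-v) := by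
    refine ⟨Real.exp ((Real.log a + Real.log b) / 2), (Real.log a - Real.log b) / 2,
      Real.exp_pos _, ?_, ?_⟩
    · rw [← Real.exp_add, ← add_div, add_add_sub_cancel, add_self_div_two, Real.exp_log ha]
    · rw [← Real.exp_add]
      conv_lhs => rw [← Real.exp_log hb]
      congr 1; ring
  -- in this variable `l u^p + (1 - l) u^(-p) = cosh s / cosh c`
  set s := c - p * v with hs
  have hv : 2 * v = m * c - m * s := by rw [hs, hp]; field_simp; ring
  have hmom : l * Real.exp v ^ p + (1 - l) * Real.exp (-v) ^ p = Real.cosh s / Real.cosh c := by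
    rw [h1l, hl, ← Real.exp_mul, ← Real.exp_mul, div_mul_eq_mul_div, div_mul_eq_mul_div,
      ← Real.exp_add, ← Real.exp_add, Real.cosh_eq s]
    rw [show -c + v * p = -s by rw [hs]; ring, show c + -v * p = s by rw [hs]; ring]
    field_simp
    ring
  have hnorm : twoPointNorm l p a b ^ 2 = P ^ 2 * (Real.cosh s ^ m / Real.cosh c ^ m) := by
    rw [ha', hb', twoPointNorm_mul hl0 hl1 hp0.ne' hP.le (Real.exp_pos _).le (Real.exp_pos _).le,
      twoPointNorm, hmom, mul_pow, ← Real.rpow_mul_natCast (by positivity),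
      ← Real.div_rpow (Real.cosh_pos s).le hC.le]
    congr 2
    rw [hp]; push_cast; field_simp
  have hco := noiseForm_coeff hm0 hc hl hr (Real.exp (m * s)) (Real.exp_pos _).ne'
  have hcosh : (Real.exp (m * s) + (Real.exp (m * s))⁻¹) / 2 = Real.cosh (m * s) := by
    rw [Real.cosh_eq, Real.exp_neg]
  rw [hcosh] at hco
  have htan := cosh_rpow_tangent_le hm1 hm2 hc s
  rw [← hco, mul_comm, ← le_div_iff₀ (by positivity)] at htan
  rw [hnorm]
  refine le_trans (le_of_eq ?_) (mul_le_mul_of_nonneg_left htan (sq_nonneg P))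
  have e1 : Real.exp (m * c) * (Real.exp (m * s))⁻¹ = Real.exp v ^ 2 := by
    rw [← Real.exp_neg, ← Real.exp_add, ← Real.exp_nat_mul]; congr 1; push_cast; linarith
  have e2 : (Real.exp (m * c))⁻¹ * Real.exp (m * s) = Real.exp (-v) ^ 2 := by
    rw [← Real.exp_neg, ← Real.exp_add, ← Real.exp_nat_mul]; congr 1; push_cast; linarith
  have e3 : Real.exp v * Real.exp (-v) = 1 := by rw [← Real.exp_add, add_neg_cancel, Real.exp_zero]
  rw [e1, e2, ha', hb']
  linear_combination 2 * P ^ 2 * (1 - r) * (l * (1 - l)) * e3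

lemma noiseForm_le {m c l r p a b : ℝ} (hm1 : 1 < m) (hm2 : m < 2) (hc : 0 < c)
    (hp : p = 2 / m) (hl0 : 0 < l) (hl1 : l < 1)
    (hl : l = Real.exp (-c) / (2 * Real.cosh c))
    (hr : r = Real.sinh ((2 - m) * c) / Real.sinh (m * c)) (ha : 0 < a) (hb : 0 ≤ b) :
    r * (l * a ^ 2 + (1 - l) * b ^ 2) + (1 - r) * (l * a + (1 - l) * b) ^ 2 ≤
      twoPointNorm l p a b ^ 2 := by
  have hp0 : 0 < p := by rw [hp]; positivity
  have h1 : Continuous fun b : ℝ =>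
      r * (l * a ^ 2 + (1 - l) * b ^ 2) + (1 - r) * (l * a + (1 - l) * b) ^ 2 := by fun_prop
  have h2 : Continuous fun b : ℝ => twoPointNorm l p a b ^ 2 := by
    have k1 := Real.continuous_rpow_const hp0.le
    have k2 := Real.continuous_rpow_const (one_div_pos.2 hp0).le
    unfold twoPointNorm
    exact (k2.comp (continuous_const.add (continuous_const.mul k1))).pow 2
  have hcl := isClosed_le h1 h2
  have : Set.Ici (0 : ℝ) ⊆ {b | r * (l * a ^ 2 + (1 - l) * b ^ 2) +
      (1 - r) * (l * a + (1 - l) * b) ^ 2 ≤ twoPointNorm l p a b ^ 2} := by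
    rw [← closure_Ioi]
    exact hcl.closure_subset_iff.2 fun b hb =>
      noiseForm_le_of_pos hm1 hm2 hc hp hl0 hl1 hl hr ha hb
  exact this hb

/-- The form `(f, g) ↦ 𝔼 (g T_r f)` is positive semidefinite, so by Cauchy–Schwarz the bound
`𝔼 (f T_r f) ≤ ‖f‖_p²` gives `𝔼 (g T_r f) ≤ ‖f‖_p ‖g‖_p`; the choice `g = (T_r f)^(q - 1)` turns
this into `‖T_r f‖_q ≤ ‖f‖_p` when `q` is conjugate to `p`. -/
lemma contractsAt_of_noiseForm_le {l p q r a b : ℝ} (hl0 : 0 < l) (hl1 : l < 1)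
    (hpq : p.HolderConjugate q) (hr0 : 0 ≤ r) (hr1 : r < 1)
    (h : ∀ a b, 0 < a → 0 ≤ b →
      r * (l * a ^ 2 + (1 - l) * b ^ 2) + (1 - r) * (l * a + (1 - l) * b) ^ 2 ≤
        twoPointNorm l p a b ^ 2) (ha : 0 < a) (hb : 0 ≤ b) :
    ContractsAt l p q r a b := by
  have h1l : 0 < 1 - l := by linarith
  have h1r : 0 < 1 - r := by linarith
  have hu : 0 < noiseFst l r a b := by unfold noiseFst; positivity
  have hv := noiseSnd_nonneg hl0 hl1 hr0 hr1 ha.le hb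
  unfold ContractsAt
  set u := noiseFst l r a b with hu'
  set v := noiseSnd l r a b with hv'
  have hfu := Real.rpow_pos_of_pos hu (q - 1)
  have hfv := Real.rpow_nonneg hv (q - 1)
  set f := u ^ (q - 1) with hf
  set g := v ^ (q - 1) with hg
  have hq1 := hpq.symm.lt
  have hpp : (q - 1) * p = q := by have := hpq.symm.sub_one_mul_conj; linarith
  have e : ∀ {z : ℝ}, 0 ≤ z → z * z ^ (q - 1) = z ^ q := by
    intro z hz
    rw [mul_comm, ← Real.rpow_add_one' hz (by linarith)]; simp
  set N₁ := twoPointNorm l p a b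
  set N₂ := twoPointNorm l p f g with hN₂
  have hN₁0 : 0 ≤ N₁ := twoPointNorm_nonneg hl0 hl1 ha.le hb
  have hN₂0 : 0 ≤ N₂ := twoPointNorm_nonneg hl0 hl1 hfu.le hfv
  have hE : 0 < l * u ^ q + (1 - l) * v ^ q := by
    have := Real.rpow_nonneg hv q
    positivity
  set E := l * u ^ q + (1 - l) * v ^ q with hEdef
  -- `E` is the value at `((a, b), (f, g))` of the positive semidefinite form
  -- `(E f)(E g) + r l (1 - l) (f₁ - f₂) (g₁ - g₂)`
  have hform : E = (l * a + (1 - l) * b) * (l * f + (1 - l) * g) +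
      r * (l * (1 - l)) * ((a - b) * (f - g)) := by
    have : E = l * (u * f) + (1 - l) * (v * g) := by rw [e hu.le, e hv]
    rw [this, hu', hv']; unfold noiseFst noiseSnd; ring
  have hw : 0 ≤ r * (l * (1 - l)) := by positivity
  have h₁ := h a b ha hb
  have h₂ := h f g hfu hfv
  have h₁' : (l * a + (1 - l) * b) ^ 2 + r * (l * (1 - l)) * (a - b) ^ 2 ≤ N₁ ^ 2 := by
    linarith
  have h₂' : (l * f + (1 - l) * g) ^ 2 + r * (l * (1 - l)) * (f - g) ^ 2 ≤ N₂ ^ 2 := by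
    linarith
  have hCS : E ^ 2 ≤ (N₁ * N₂) ^ 2 := by
    rw [mul_pow]
    refine le_trans ?_ (mul_le_mul h₁' h₂' (by positivity) (by positivity))
    rw [hform]
    have cs : ∀ s t d e k : ℝ, 0 ≤ k →
        (s * t + k * (d * e)) ^ 2 ≤ (s ^ 2 + k * d ^ 2) * (t ^ 2 + k * e ^ 2) := by
      intro s t d e k hk
      linear_combination mul_nonneg hk (sq_nonneg (s * e - t * d))
    exact cs _ _ _ _ _ hw
  have hle : E ≤ N₁ * N₂ := (sq_le_sq₀ hE.le (mul_nonneg hN₁0 hN₂0)).1 hCS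
  have hnf : N₂ = E ^ (1 / p) := by
    rw [hN₂, twoPointNorm, hf, hg, ← Real.rpow_mul hu.le, ← Real.rpow_mul hv, hpp]
  rw [hnf] at hle
  have hsplit : E = E ^ (1 / q) * E ^ (1 / p) := by
    rw [← Real.rpow_add hE, one_div, one_div, hpq.symm.inv_add_inv_eq_one, Real.rpow_one]
  rw [twoPointNorm, ← hEdef]
  nth_rewrite 1 [hsplit] at hle
  exact le_of_mul_le_mul_right hle (by positivity)

/-- With `κ = l / (1 - l) = exp(-2 c)`, `m = 2 / p` and `2 - m = 2 / q`, the pair `x = κ^(2/p)`,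
`y = κ^(2/q)` solves the system; here `x^p = y^q = κ²`, `x^(p - 1) = y` and `y^(q - 1) = x`. -/
lemma exists_isSystemSolution_conjugate {m c l p q : ℝ} (hm1 : 1 < m) (hm2 : m < 2) (hc : 0 < c)
    (hp : p = 2 / m) (hq : q = 2 / (2 - m)) (hl : l = Real.exp (-c) / (2 * Real.cosh c)) :
    ∃ x y, IsSystemSolution l p q x y ∧
      crossValue l x y = Real.sinh ((2 - m) * c) / Real.sinh (m * c) := by
  have hm0 : 0 < m := by linarith
  have hm2' : 0 < 2 - m := by linarith
  have h1l := one_sub_eq_of_eq_exp_div hl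
  have hC := Real.cosh_pos c
  have hd : l + (1 - l) * Real.exp (-(4 * c)) = Real.exp (-(2 * c)) := by
    rw [h1l, hl, div_mul_eq_mul_div, ← Real.exp_add, ← add_div, div_eq_iff (by positivity),
      Real.cosh_eq, mul_div_cancel₀ _ two_ne_zero, mul_add, ← Real.exp_add, ← Real.exp_add,
      add_comm]
    ring_nf
  have hmean : ∀ t : ℝ, l + (1 - l) * Real.exp (-(2 * c * t)) =
      (Real.exp (-c) + Real.exp (c - 2 * c * t)) / (2 * Real.cosh c) := by
    intro t
    rw [h1l, hl, div_mul_eq_mul_div, ← Real.exp_add, ← add_div, sub_eq_add_neg]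
  refine ⟨Real.exp (-(2 * c * m)), Real.exp (-(2 * c * (2 - m))),
    ⟨⟨Real.exp_pos _, Real.exp_lt_one_iff.2 (by simp; positivity)⟩,
      ⟨Real.exp_pos _, Real.exp_lt_one_iff.2 (by simp; positivity)⟩, ?_, ?_⟩, ?_⟩
  · rw [← Real.exp_mul, ← Real.exp_mul,
      show -(2 * c * m) * p = -(4 * c) by rw [hp]; field_simp; norm_num,
      show -(2 * c * (2 - m)) * q = -(4 * c) by rw [hq]; field_simp; norm_num, hd, hmean, hmean,
      ← Real.exp_mul, ← Real.exp_mul, div_eq_div_iff (by positivity) (by positivity)]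
    rw [← mul_div_assoc (Real.exp _) (_ + _), ← mul_div_assoc (Real.exp _) (_ + _)]
    congr 1
    rw [mul_add, mul_add, ← Real.exp_add, ← Real.exp_add, ← Real.exp_add, ← Real.exp_add, add_comm]
    congr 2
    · rw [hp, hq]; field_simp; ring
    · rw [hp, hq]; field_simp; ring
  · rw [← Real.exp_mul, ← Real.exp_mul, ← Real.exp_mul, ← Real.exp_mul,
      show -(2 * c * m) * p = -(4 * c) by rw [hp]; field_simp; norm_num,
      show -(2 * c * (2 - m)) * q = -(4 * c) by rw [hq]; field_simp; norm_num,
      show -(2 * c * m) * (p - 1) = -(2 * c * (2 - m)) by rw [hp]; field_simp,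
      show -(2 * c * (2 - m)) * (q - 1) = -(2 * c * m) by rw [hq]; field_simp; ring,
      mul_comm (1 - Real.exp (-(2 * c * m)))]
  · have hκ : l / (1 - l) = Real.exp (-(2 * c)) := by
      rw [h1l, hl, div_div_div_cancel_right₀ (by positivity), ← Real.exp_sub]; ring_nf
    have hE : 1 < Real.exp c := Real.one_lt_exp_iff.2 hc
    have hM : 1 < Real.exp (m * c) := Real.one_lt_exp_iff.2 (by positivity)
    have e1 : Real.exp (-(2 * c)) = (Real.exp c ^ 2)⁻¹ := by
      rw [← Real.exp_nat_mul, ← Real.exp_neg]; push_cast; rfl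
    have e2 : Real.exp (-(m * c)) = (Real.exp (m * c))⁻¹ := Real.exp_neg _
    have e3 : Real.exp ((2 - m) * c) = Real.exp c ^ 2 * (Real.exp (m * c))⁻¹ := by
      rw [← e2, ← Real.exp_nat_mul, ← Real.exp_add]; congr 1; push_cast; ring
    have e4 : Real.exp (-((2 - m) * c)) = (Real.exp c ^ 2)⁻¹ * Real.exp (m * c) := by
      rw [Real.exp_neg, e3, mul_inv, inv_inv]
    have e5 : Real.exp (-(2 * c * m)) = (Real.exp (m * c))⁻¹ ^ 2 := by
      rw [← e2, ← Real.exp_nat_mul]; congr 1; push_cast; ring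
    have e6 : Real.exp (-(2 * c * (2 - m))) = ((Real.exp c ^ 2)⁻¹ * Real.exp (m * c)) ^ 2 := by
      rw [← e4, ← Real.exp_nat_mul]; congr 1; push_cast; ring
    rw [crossValue, hκ, Real.sinh_eq, Real.sinh_eq, e1, e2, e3, e4, e5, e6]
    set E := Real.exp c
    set M := Real.exp (m * c)
    have hE0 : 0 < E := by linarith
    have hM0 : 0 < M := by linarith
    have h1 : M ^ 2 - 1 ≠ 0 := by nlinarith
    have h2 : E ^ 2 + M ^ 2 ≠ 0 := by positivity
    have h3 : M - M⁻¹ = (M ^ 2 - 1) / M := by field_simp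
    have h4 : 1 - M⁻¹ ^ 2 = (M ^ 2 - 1) / M ^ 2 := by field_simp
    have h5 : ((E ^ 2)⁻¹ * M) ^ 2 + (E ^ 2)⁻¹ = (E ^ 2 + M ^ 2) / E ^ 4 := by field_simp; ring
    have h6 : M⁻¹ ^ 2 + (E ^ 2)⁻¹ = (E ^ 2 + M ^ 2) / (M ^ 2 * E ^ 2) := by field_simp
    rw [h3, h4, h5, h6]
    field_simp

lemma sinh_ratio_mem_feasibleSet {m c l p q : ℝ} (hm1 : 1 < m) (hm2 : m < 2) (hc : 0 < c)
    (hp : p = 2 / m) (hq : q = 2 / (2 - m)) (hl0 : 0 < l) (hl1 : l < 1)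
    (hl : l = Real.exp (-c) / (2 * Real.cosh c)) :
    Real.sinh ((2 - m) * c) / Real.sinh (m * c) ∈ feasibleSet l p q := by
  have hm0 : 0 < m := by linarith
  have hm2' : 0 < 2 - m := by linarith
  have h1l : 0 < 1 - l := by linarith
  have hp0 : 0 < p := by rw [hp]; positivity
  have hq0 : 0 < q := by rw [hq]; positivity
  have hS : 0 < Real.sinh (m * c) := Real.sinh_pos_iff.2 (by positivity)
  have hr0 : 0 ≤ Real.sinh ((2 - m) * c) / Real.sinh (m * c) :=
    div_nonneg (Real.sinh_nonneg_iff.2 (by positivity)) hS.le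
  have hr1 : Real.sinh ((2 - m) * c) / Real.sinh (m * c) < 1 := by
    rw [div_lt_one hS, Real.sinh_lt_sinh]
    nlinarith
  have hconj : p.HolderConjugate q := by
    rw [Real.holderConjugate_iff, hp, hq]
    refine ⟨by rw [lt_div_iff₀ hm0]; linarith, by field_simp; ring⟩
  refine ⟨hr0, hr1, fun ρ hρ => ?_⟩
  have h1 := hρ.2
  have h0 := hρ.1
  rw [le_div_iff₀ hl0] at h1
  rw [← contractsAt_iff_affineNorm hl0 hl1 hp0 hq0 hr0 hr1 one_pos (by positivity) (by linarith)]
  exact contractsAt_of_noiseForm_le hl0 hl1 hconj hr0 hr1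
    (fun a b ha hb => noiseForm_le hm1 hm2 hc hp hl0 hl1 hl rfl ha hb) (by positivity)
    (by linarith)

theorem theorem2 {Ω : Type*} [MeasurableSpace Ω] (μ : Measure Ω) [IsProbabilityMeasure μ]
    (X : Ω → ℝ) (l p q : ℝ) (hl0 : 0 < l) (hl1 : l < 1 / 2) (hp : 1 < p) (hpq : p < q)
    (hX : IsBiasedBernoulli X l μ) :
    -- the supremum defining the optimal constant is attained
    IsGreatest {r : ℝ | IsHypercontractive X p q r μ} (optimalConst X p q μ) ∧
    -- it is the value at a solution of the system, the least one over all solutions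
    (∃ x y : ℝ, IsSystemSolution l p q x y ∧ optimalConst X p q μ = crossValue l x y) ∧
    (∀ x y : ℝ, IsSystemSolution l p q x y → optimalConst X p q μ ≤ crossValue l x y) ∧
    -- explicit value when `q` is the conjugate exponent of `p`
    (q = p / (p - 1) →
      optimalConst X p q μ =
        Real.sinh (1 / q * Real.log ((1 - l) / l)) /
          Real.sinh (1 / p * Real.log ((1 - l) / l))) := by
  have hl1' : l < 1 := by linarith
  have h1l : 0 < 1 - l := by linarith
  have hset : {r : ℝ | IsHypercontractive X p q r μ} = feasibleSet l p q := by
    ext r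
    refine (hX.isHypercontractive_iff hl0 hl1' (by linarith) (by linarith) r).trans ?_
    exact ⟨fun h => ⟨h.1, h.2.1, fun ρ _ => h.2.2 ρ⟩, fun h => ⟨h.1, h.2.1,
      affineNorm_le_of_forall_mem_Icc hl0 hl1 hp hpq h.1 h.2.1 h.2.2⟩⟩
  obtain ⟨σ, hσ, ρ, hρ, htight⟩ := exists_isGreatest_feasibleSet hl0 hl1 hp hpq
  have hopt : optimalConst X p q μ = σ := by rw [optimalConst, hset, hσ.csSup_eq]
  rw [hopt, hset]
  refine ⟨hσ, exists_isSystemSolution_of_tight hl0 hl1' hp hpq hσ.1 hρ htight,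
    fun x y h => le_crossValue hl0 hl1' hp hpq hσ.1 h, fun hq => ?_⟩
  -- parametrize by `c = log ((1 - l) / l) / 2` and `m = 2 / p`
  obtain ⟨c, hc⟩ : ∃ c, Real.log ((1 - l) / l) = 2 * c := ⟨_, (mul_div_cancel₀ _ two_ne_zero).symm⟩
  have hp0 : 0 < p := by linarith
  have hp1 : 0 < p - 1 := by linarith
  have hp2 : p < 2 := by
    rw [hq, lt_div_iff₀ hp1] at hpq
    nlinarith
  have hc0 : 0 < c := by
    have : 0 < Real.log ((1 - l) / l) := Real.log_pos (by rw [lt_div_iff₀ hl0]; linarith)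
    linarith
  have hl : l = Real.exp (-c) / (2 * Real.cosh c) := by
    have h2 : Real.exp c * Real.exp c = (1 - l) / l := by
      rw [← Real.exp_add, ← two_mul, ← hc, Real.exp_log (by positivity)]
    rw [eq_div_iff hl0.ne'] at h2
    have := Real.exp_pos c
    rw [Real.cosh_eq, Real.exp_neg]
    field_simp
    linarith
  have hm1 : 1 < 2 / p := by rw [lt_div_iff₀ hp0]; linarith
  have hm2 : 2 / p < 2 := by rw [div_lt_iff₀ hp0]; linarith
  have hpm : p = 2 / (2 / p) := by field_simp
  have hqm : q = 2 / (2 - 2 / p) := by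
    rw [hq, show 2 - 2 / p = 2 * (p - 1) / p by field_simp]
    field_simp
  have e1 : 1 / q * (2 * c) = (2 - 2 / p) * c := by
    rw [hq]; field_simp
  have e2 : 1 / p * (2 * c) = 2 / p * c := by field_simp
  rw [hc, e1, e2]
  obtain ⟨x, y, hxy, hval⟩ := exists_isSystemSolution_conjugate hm1 hm2 hc0 hpm hqm hl
  refine le_antisymm ?_ (hσ.2 (sinh_ratio_mem_feasibleSet hm1 hm2 hc0 hpm hqm hl0 hl1' hl))
  rw [← hval]
  exact le_crossValue hl0 hl1' hp hpq hσ.1 hxy
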